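/- **Setting.** Let $\mathbb K=\mathbb R$ or $\mathbb C$, $N\ge 1$, $l\ge 1$, $m=2l$, $0<\rho\le 1$, and let $\Omega\subset\mathbb R^N$ be a bounded domain (nonempty, open, connected) whose boundary is of class $C^1$ (at least). $C^k(\overline\Omega)$ denotes the functions that are continuous on $\overline\Omega$, of class $C^k$ in $\Omega$, and all of whose partial derivatives of order $\le k$ extend continuously from $\Omega$ to $\overline\Omega$; derivatives at boundary points are understood as the values of these extensions. Write $D_j=\partial/\partial x_j$. Let $A(x,D)=\sum_{|\alpha|\le m}a_\alpha(x)D^\alpha$ with $a_\alpha\in C^{|\alpha|}(\overline\Omega)$ be * elliptic in $\Omega$: $(-1)^l\sum_{|\alpha|=m}a_\alpha(x)\xi^\alpha>0$ for all $x\in\Omega$, $0\ne\xi\in\mathbb R^N$; * formally selfadjoint and positive: $(A\eta,\theta)=(\eta,A\theta)$ and $(A\eta,\eta)>0$ for $\eta\neq0$, for all $\eta,\theta\in C_c^\infty(\Omega)$, where $(\cdot,\cdot)$ is the scalar product of $L_2(\Omega)$. For $j=1,\dots,l$ let $0\le m_j\le m-1$ and let $B_j=\sum_{|\alpha|\le m_j}b_{\alpha,j}(x)D^\alpha$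 with given functions $b_{\alpha,j}$ on $\partial\Omega$. Put $D(A)=\{g\in C^m(\overline\Omega): B_jg=0 \text{ on }\partial\Omega,\ j=1,\dots,l\}$. **Condition (A).** The operator $A(x,D)$ with domain $D(A)$ has a compact inverse in $L_2(\Omega)$, i.e. there is a compact linear operator $T$ on $L_2(\Omega)$ with $T(A(x,D)g)=g$ for all $g\in D(A)$; and there are functions $v_k\in D(A)$ and numbers $\lambda_k>0$, $k\in\mathbb N$, with $A(x,D)v_k=\lambda_kv_k$ in $\Omega$, such that $\{v_k\}$ is a complete orthonormal system in $L_2(\Omega)$. (Agmon's conditions on $\partial\Omega$ and on the coefficients of $A$ and $B_j$ are conditions that guarantee this.) **Fractional derivatives.** For $s<0$, $\partial_t^{s}h(t)=\frac1{\Gamma(-s)}\int_0^t (t-\xi)^{-s-1}h(\xi)\,d\xi$, $t>0$ (provided the integral exists); $\partial_t^0h=h$; and $\partial_t^\rho h=\frac{d}{dt}\partial_t^{\rho-1}h$ for $0<\rho\le1$ (Riemann–Liouville). **Problem.** Given $f$ and $\varphi$, consider $$\partial_t^\rho u(x,t)+A(x,D)u(x,t)=f(x,t),\quad x\in\Omega,\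 t>0;\qquad \lim_{t\to0+}\partial_t^{\rho-1}u(x,t)=\varphi(x),\quad x\in\Omega;$$ $$B_ju(x,t)=0,\quad j=1,\dots,l,\ x\in\partial\Omega,\ t>0.$$ A *regular solution* is a function $u:\overline\Omega\times(0,\infty)\to\mathbb K$ with $u(\cdot,t)\in C^m(\overline\Omega)$ for every $t>0$, for which $\partial_t^{\rho-1}u$ and $\partial_t^\rho u$ exist in $\Omega\times(0,\infty)$, such that $\partial_t^\rho u,\ A(x,D)u\in C(\overline\Omega\times(0,\infty))$ and $\partial_t^{\rho-1}u\in C(\overline\Omega\times[0,\infty))$ (in the sense of continuous extension from $\Omega\times(0,\infty)$), and which satisfies the three conditions of the problem pointwise. **Theorem.** Let condition (A) be satisfied, $f\in C(\overline\Omega\times(0,\infty))$ and $\varphi\in C(\overline\Omega)$. Then the problem has at most one regular solution: any two regular solutions coincide on $\overline\Omega\times(0,\infty)$. -/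

import Mathlib

open MeasureTheory Filter Topology Set

noncomputable section

namespace Subdiffusion

/-- The space `ℝ^N` with its Euclidean structure. -/
abbrev Sp (N : ℕ) : Type := EuclideanSpace ℝ (Fin N)

/-- The Hilbert space `L₂(Ω)`. -/
abbrev L2 (𝕜 : Type) [RCLike 𝕜] {N : ℕ} (Ω : Set (Sp N)) : Type :=
  Lp 𝕜 2 (volume.restrict Ω)

/-! ### Multi-indices and partial derivatives -/

/-- The multi-indices `α` with `|α| ≤ k`. -/
def multiIdx (N k : ℕ) : Finset (Fin N → ℕ) :=
  (Fintype.piFinset fun _ : Fin N => Finset.range (k + 1)).filter fun α => ∑ i, α i ≤ k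

/-- The partial derivative `D_i g = ∂g/∂x_i`. -/
def partialD {𝕜 : Type} [RCLike 𝕜] {N : ℕ} (i : Fin N) (g : Sp N → 𝕜) : Sp N → 𝕜 :=
  fun x => fderiv ℝ g x (EuclideanSpace.single i 1)

/-- `D^α g = D_1^{α_1} ⋯ D_N^{α_N} g`. -/
def multiD {𝕜 : Type} [RCLike 𝕜] {N : ℕ} (α : Fin N → ℕ) (g : Sp N → 𝕜) : Sp N → 𝕜 :=
  (List.finRange N).foldr (fun i h => (partialD i)^[α i] h) g

/-- `g ∈ C^k(Ω̄)`: `g` is `C^k` in the open set `Ω`, continuous on `Ω̄`, and every derivative of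
order at most `k` has a continuous extension from `Ω` to `Ω̄`. -/
def CkClosure {𝕜 : Type} [RCLike 𝕜] {N : ℕ} (Ω : Set (Sp N)) (k : ℕ) (g : Sp N → 𝕜) : Prop :=
  ContDiffOn ℝ k g Ω ∧ ContinuousOn g (closure Ω) ∧
    ∀ α ∈ multiIdx N k, ∃ G : Sp N → 𝕜, ContinuousOn G (closure Ω) ∧ EqOn G (multiD α g) Ω

/-! ### The domain -/

/-- `Ω` is a bounded domain with boundary of class `C¹`: near each boundary point, `Ω` is the set
where a `C¹` function with nonvanishing differential at that point is negative. -/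
structure IsSmoothBoundedDomain {N : ℕ} (Ω : Set (Sp N)) : Prop where
  isOpen : IsOpen Ω
  isConnected : IsConnected Ω
  isBounded : Bornology.IsBounded Ω
  boundary : ∀ x₀ ∈ frontier Ω, ∃ (W : Set (Sp N)) (ψ : Sp N → ℝ), IsOpen W ∧ x₀ ∈ W ∧
    ContDiffOn ℝ 1 ψ W ∧ ψ x₀ = 0 ∧ fderiv ℝ ψ x₀ ≠ 0 ∧ Ω ∩ W = {x ∈ W | ψ x < 0}

/-! ### The differential operators -/

/-- `(A(x,D) g)(x) = ∑_{|α| ≤ m} a_α(x) D^α g(x)`. -/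
def diffOp {𝕜 : Type} [RCLike 𝕜] {N : ℕ} (m : ℕ) (a : (Fin N → ℕ) → Sp N → 𝕜)
    (g : Sp N → 𝕜) : Sp N → 𝕜 :=
  fun x => ∑ α ∈ multiIdx N m, a α x * multiD α g x

/-- `∑_{|α| ≤ k} b_α(x) D^α g(x)` at boundary points `x`, where the values `D^α g(x)` are the limits
of `D^α g` from inside `Ω`. -/
def bdryOp {𝕜 : Type} [RCLike 𝕜] {N : ℕ} (Ω : Set (Sp N)) (k : ℕ) (b : (Fin N → ℕ) → Sp N → 𝕜)
    (g : Sp N → 𝕜) : Sp N → 𝕜 :=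
  fun x => ∑ α ∈ multiIdx N k, b α x * extendFrom Ω (multiD α g) x

/-- Test functions `C_c^∞(Ω)`. -/
def IsTest {𝕜 : Type} [RCLike 𝕜] {N : ℕ} (Ω : Set (Sp N)) (η : Sp N → 𝕜) : Prop :=
  ContDiff ℝ (⊤ : ℕ∞) η ∧ HasCompactSupport η ∧ tsupport η ⊆ Ω

/-- `A(x,D)` is a positive formally selfadjoint elliptic operator of order `2l` in `Ω` with smooth
coefficients. As `D_j` is `∂/∂x_j`, the principal symbol is
`∑_{|α| = 2l} a_α (iξ)^α = (-1)^l ∑_{|α| = 2l} a_α ξ^α`. -/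
structure IsPosSymmElliptic {𝕜 : Type} [RCLike 𝕜] {N : ℕ} (Ω : Set (Sp N)) (l : ℕ)
    (a : (Fin N → ℕ) → Sp N → 𝕜) : Prop where
  smooth : ∀ α ∈ multiIdx N (2 * l), CkClosure Ω (∑ i, α i) (a α)
  elliptic : ∀ x ∈ Ω, ∀ ξ : Fin N → ℝ, ξ ≠ 0 → ∃ r : ℝ, 0 < r ∧
    (-1 : 𝕜) ^ l * ∑ α ∈ (multiIdx N (2 * l)).filter (fun α => ∑ i, α i = 2 * l),
      a α x * ((∏ i, ξ i ^ α i : ℝ) : 𝕜) = (r : 𝕜)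
  symm : ∀ η θ : Sp N → 𝕜, IsTest Ω η → IsTest Ω θ →
    ∫ x in Ω, diffOp (2 * l) a η x * star (θ x) = ∫ x in Ω, η x * star (diffOp (2 * l) a θ x)
  pos : ∀ η : Sp N → 𝕜, IsTest Ω η → η ≠ 0 →
    0 < RCLike.re (∫ x in Ω, diffOp (2 * l) a η x * star (η x))

/-- The domain `D(A) = {g ∈ C^m(Ω̄) : B_j g = 0 on ∂Ω, j = 1, …, l}`, `m = 2l`. -/
def InDomain {𝕜 : Type} [RCLike 𝕜] {N : ℕ} (Ω : Set (Sp N)) (l : ℕ) (mB : Fin l → ℕ)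
    (b : Fin l → (Fin N → ℕ) → Sp N → 𝕜) (g : Sp N → 𝕜) : Prop :=
  CkClosure Ω (2 * l) g ∧ ∀ j, ∀ x ∈ frontier Ω, bdryOp Ω (mB j) (b j) g x = 0

/-- Condition (A) on the boundary problem `(A, {B_j}, Ω)`: the operator `A(x,D)` with domain `D(A)`
has a compact inverse in `L₂(Ω)`, and the spectral problem `A v = λ v`, `B_j v = 0`, has a system
of eigenfunctions `v_k` with positive eigenvalues `λ_k` that is orthonormal and complete
in `L₂(Ω)`. -/
structure ConditionA {𝕜 : Type} [RCLike 𝕜] {N : ℕ} (Ω : Set (Sp N)) (l : ℕ)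
    (a : (Fin N → ℕ) → Sp N → 𝕜) (mB : Fin l → ℕ)
    (b : Fin l → (Fin N → ℕ) → Sp N → 𝕜) : Prop where
  compact_inverse : ∃ T : L2 𝕜 Ω →L[𝕜] L2 𝕜 Ω, IsCompactOperator T ∧
    ∀ g : Sp N → 𝕜, InDomain Ω l mB b g → ∀ F G : L2 𝕜 Ω,
      F =ᵐ[volume.restrict Ω] diffOp (2 * l) a g → G =ᵐ[volume.restrict Ω] g → T F = G
  eigenfunctions : ∃ (v : ℕ → Sp N → 𝕜) (lam : ℕ → ℝ) (V : ℕ → L2 𝕜 Ω),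
    (∀ k, InDomain Ω l mB b (v k)) ∧
    (∀ k, 0 < lam k) ∧
    (∀ k, ∀ x ∈ Ω, diffOp (2 * l) a (v k) x = (lam k : 𝕜) * v k x) ∧
    (∀ k, V k =ᵐ[volume.restrict Ω] v k) ∧
    Orthonormal 𝕜 V ∧
    (Submodule.span 𝕜 (range V)).topologicalClosure = ⊤

/-! ### Riemann–Liouville integrals and derivatives -/

/-- `∂_t^s h(t)` for `s ≤ 0`: the Riemann–Liouville integral
`Γ(-s)⁻¹ ∫_0^t (t - ξ)^{-s-1} h(ξ) dξ` if `s < 0`, and `h(t)` if `s = 0`. -/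
def rlInt {𝕜 : Type} [RCLike 𝕜] (s : ℝ) (h : ℝ → 𝕜) (t : ℝ) : 𝕜 :=
  if s = 0 then h t
  else (Real.Gamma (-s))⁻¹ • ∫ ξ in (0 : ℝ)..t, ((t - ξ) ^ (-s - 1) : ℝ) • h ξ

/-- The right-hand side in the definition of `∂_t^s h(t)`, `s ≤ 0`, exists. -/
def RlIntExists {𝕜 : Type} [RCLike 𝕜] (s : ℝ) (h : ℝ → 𝕜) (t : ℝ) : Prop :=
  s ≠ 0 → IntervalIntegrable (fun ξ => ((t - ξ) ^ (-s - 1) : ℝ) • h ξ) volume 0 t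

/-- The Riemann–Liouville derivative `∂_t^ρ h = (d/dt) ∂_t^{ρ-1} h`, `0 < ρ ≤ 1`. -/
def rlDeriv {𝕜 : Type} [RCLike 𝕜] (ρ : ℝ) (h : ℝ → 𝕜) (t : ℝ) : 𝕜 :=
  deriv (rlInt (ρ - 1) h) t

/-! ### Regular solutions -/

/-- The function `h`, considered on `Ω × (0,∞)`, belongs to `C(Ω̄ × I)`: it has a continuous
extension to `Ω̄ × I`. -/
def ExtendsCont {𝕜 : Type} [RCLike 𝕜] {N : ℕ} (Ω : Set (Sp N)) (I : Set ℝ)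
    (h : Sp N → ℝ → 𝕜) : Prop :=
  ∃ H : Sp N → ℝ → 𝕜, ContinuousOn (Function.uncurry H) (closure Ω ×ˢ I) ∧
    ∀ x ∈ Ω, ∀ t > 0, H x t = h x t

/-- `u` is a regular solution of `∂_t^ρ u + A(x,D) u = f` in `Ω × (0,∞)`,
`lim_{t → 0} ∂_t^{ρ-1} u = φ` in `Ω`, `B_j u = 0` on `∂Ω × (0,∞)`. -/
structure IsRegularSolution {𝕜 : Type} [RCLike 𝕜] {N : ℕ} (Ω : Set (Sp N)) (l : ℕ)
    (a : (Fin N → ℕ) → Sp N → 𝕜) (mB : Fin l → ℕ) (b : Fin l → (Fin N → ℕ) → Sp N → 𝕜)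
    (ρ : ℝ) (f : Sp N → ℝ → 𝕜) (φ : Sp N → 𝕜) (u : Sp N → ℝ → 𝕜) : Prop where
  space_regular : ∀ t > 0, CkClosure Ω (2 * l) fun x => u x t
  integral_exists : ∀ x ∈ Ω, ∀ t > 0, RlIntExists (ρ - 1) (u x) t
  deriv_exists : ∀ x ∈ Ω, ∀ t > 0, DifferentiableAt ℝ (rlInt (ρ - 1) (u x)) t
  continuous_rlDeriv : ExtendsCont Ω (Ioi 0) fun x t => rlDeriv ρ (u x) t
  continuous_diffOp : ExtendsCont Ω (Ioi 0) fun x t => diffOp (2 * l) a (fun y => u y t) x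
  continuous_rlInt : ExtendsCont Ω (Ici 0) fun x t => rlInt (ρ - 1) (u x) t
  equation : ∀ x ∈ Ω, ∀ t > 0,
    rlDeriv ρ (u x) t + diffOp (2 * l) a (fun y => u y t) x = f x t
  initial : ∀ x ∈ Ω, Tendsto (rlInt (ρ - 1) (u x)) (𝓝[>] 0) (𝓝 (φ x))
  boundary : ∀ j, ∀ t > 0, ∀ x ∈ frontier Ω, bdryOp Ω (mB j) (b j) (fun y => u y t) x = 0

end Subdiffusion

end

/-!
By linearity it suffices that a regular solution `u` of the homogeneous problem vanishes. Put
`H = ∂_t^{ρ-1} u` and `G = ∂_t^ρ u = dH/dt`. Since `A u = -G` and `T` inverts `A`, we have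
`u = -T G`, so that the coefficients of `u` and `G` at the eigenfunction `v_k` satisfy
`⟨v_k, u⟩ = κ ⟨v_k, G⟩` with `κ = -λ_k⁻¹`. Integrate this in time and use `∂_t^{-ρ} H = ∫₀ᵗ u`:
as `H` vanishes at `t = 0`, the coefficient `J = ⟨v_k, H⟩` solves the homogeneous Volterra equation
`∂_t^{-ρ} J = κ J` with weakly singular kernel, whose only bounded solution is `J = 0`. Completeness
of the eigenfunctions gives `H = 0`, whence `G = 0` and `u = -T 0 = 0`.

The boundary regularity of a regular solution does not make `u` integrable on `Ω × (0, t)`; only the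
bound `‖u(·, s)‖ ≤ ‖T‖ ‖G(·, s)‖` on compact time intervals in `(0, ∞)` is at hand. Therefore the
integration in time starts at `ε > 0`, and `ε → 0` is taken afterwards.
-/

noncomputable section

namespace Subdiffusion

section RiemannLiouville

open ProbabilityTheory in
theorem integral_sub_rpow_mul_sub_rpow {a b r t : ℝ} (ha : 0 < a) (hb : 0 < b) (hrt : r < t) :
    ∫ s in r..t, (t - s) ^ (a - 1) * (s - r) ^ (b - 1) = beta a b * (t - r) ^ (a + b - 1) := by
  have htr : 0 < t - r := sub_pos.2 hrt
  have hshift : ∫ s in r..t, (t - s) ^ (a - 1) * (s - r) ^ (b - 1) =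
      ∫ x in (0 : ℝ)..(t - r), x ^ (b - 1) * ((t - r) - x) ^ (a - 1) := by
    rw [← sub_self r, ← intervalIntegral.integral_comp_sub_right]
    exact intervalIntegral.integral_congr fun s _ => by ring_nf
  have hcast : ∫ x in (0 : ℝ)..(t - r), (x : ℂ) ^ ((b : ℂ) - 1) *
      (((t - r : ℝ) : ℂ) - x) ^ ((a : ℂ) - 1) =
      ∫ x in (0 : ℝ)..(t - r), ((x ^ (b - 1) * ((t - r) - x) ^ (a - 1) : ℝ) : ℂ) := by
    refine intervalIntegral.integral_congr fun x hx => ?_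
    rw [uIcc_of_le htr.le] at hx
    push_cast [Complex.ofReal_cpow hx.1, Complex.ofReal_cpow (sub_nonneg.2 hx.2)]
    rfl
  have hbeta := Complex.betaIntegral_scaled b a htr
  rw [hcast, intervalIntegral.integral_ofReal, ← Complex.ofReal_add, ← Complex.ofReal_one,
    ← Complex.ofReal_sub, ← Complex.ofReal_cpow htr.le] at hbeta
  rw [hshift, ← Complex.ofReal_re (∫ x in (0 : ℝ)..(t - r), _), hbeta, Complex.re_ofReal_mul,
    ← beta_eq_betaIntegralReal b a hb ha, add_comm b a, mul_comm, beta, beta,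
    mul_comm (Real.Gamma b), add_comm b a]

theorem intervalIntegrable_sub_rpow_mul_sub_rpow {a b r t : ℝ} (ha : 0 < a) (hb : 0 < b)
    (hrt : r < t) :
    IntervalIntegrable (fun s => (t - s) ^ (a - 1) * (s - r) ^ (b - 1)) volume r t :=
  not_imp_comm.1 intervalIntegral.integral_undef <| by
    rw [integral_sub_rpow_mul_sub_rpow ha hb hrt]
    exact (mul_pos (ProbabilityTheory.beta_pos ha hb) (Real.rpow_pos_of_pos (sub_pos.2 hrt) _)).ne'

section Triangle

variable {E : Type*} [NormedAddCommGroup E] {a b : ℝ}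

theorem setIntegral_Ioc_indicator_Ioi [NormedSpace ℝ E] {r : ℝ} (hr : r ∈ Ioc a b) (f : ℝ → E) :
    ∫ s in Ioc a b, (Ioi r).indicator f s = ∫ s in r..b, f s := by
  rw [setIntegral_indicator measurableSet_Ioi, Ioc_inter_Ioi, max_eq_right hr.1.le,
    intervalIntegral.integral_of_le hr.2]

theorem setIntegral_Ioc_indicator_Iio [NormedSpace ℝ E] {s : ℝ} (hs : s ∈ Ioc a b) (f : ℝ → E) :
    ∫ r in Ioc a b, (Iio s).indicator f r = ∫ r in a..s, f r := by
  have : Ioc a b ∩ Iio s = Ioo a s := by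
    ext r
    exact ⟨fun h => ⟨h.1.1, h.2⟩, fun h => ⟨⟨h.1, h.2.le.trans hs.2⟩, h.2⟩⟩
  rw [setIntegral_indicator measurableSet_Iio, this, ← integral_Ioc_eq_integral_Ioo,
    intervalIntegral.integral_of_le hs.1.le]

theorem integrable_indicator_lt_prod {f : ℝ → ℝ → E}
    (hm : AEStronglyMeasurable (Function.uncurry f)
      ((volume.restrict (Ioc a b)).prod (volume.restrict (Ioc a b))))
    (hf : ∀ᵐ r ∂volume.restrict (Ioc a b), IntervalIntegrable (f r) volume r b)
    (hf' : IntegrableOn (fun r => ∫ s in r..b, ‖f r s‖) (Ioc a b)) :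
    Integrable ({p : ℝ × ℝ | p.1 < p.2}.indicator (Function.uncurry f))
      ((volume.restrict (Ioc a b)).prod (volume.restrict (Ioc a b))) := by
  refine (integrable_prod_iff
    (hm.indicator (measurableSet_lt measurable_fst measurable_snd))).2 ⟨?_, ?_⟩
  · filter_upwards [hf, ae_restrict_mem measurableSet_Ioc] with r hfr hr
    change Integrable ((Ioi r).indicator (f r)) _
    rw [integrable_indicator_iff measurableSet_Ioi, IntegrableOn,
      Measure.restrict_restrict measurableSet_Ioi, inter_comm, Ioc_inter_Ioi, max_eq_right hr.1.le]
    exact hfr.1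
  · refine hf'.congr_fun (fun r hr => ?_) measurableSet_Ioc
    simp only [norm_indicator_eq_indicator_norm]
    exact (setIntegral_Ioc_indicator_Ioi hr fun s => ‖f r s‖).symm

theorem integral_integral_swap_of_lt [NormedSpace ℝ E] (hab : a ≤ b) {f : ℝ → ℝ → E}
    (hf : Integrable ({p : ℝ × ℝ | p.1 < p.2}.indicator (Function.uncurry f))
      ((volume.restrict (Ioc a b)).prod (volume.restrict (Ioc a b)))) :
    ∫ s in a..b, ∫ r in a..s, f r s = ∫ r in a..b, ∫ s in r..b, f r s := by
  rw [intervalIntegral.integral_of_le hab, intervalIntegral.integral_of_le hab,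
    ← setIntegral_congr_fun measurableSet_Ioc
      fun s hs => setIntegral_Ioc_indicator_Iio hs fun r => f r s,
    ← setIntegral_congr_fun measurableSet_Ioc fun r hr => setIntegral_Ioc_indicator_Ioi hr (f r)]
  exact (integral_integral_swap
    (f := fun r s => {p : ℝ × ℝ | p.1 < p.2}.indicator (Function.uncurry f) (r, s)) hf).symm

end Triangle

variable {𝕜 : Type} [RCLike 𝕜] {a b s t : ℝ} {g h : ℝ → 𝕜}

theorem rlInt_zero (h : ℝ → 𝕜) : rlInt 0 h = h :=
  funext fun _ => if_pos rfl

theorem rlInt_neg (ha : 0 < a) (h : ℝ → 𝕜) (t : ℝ) :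
    rlInt (-a) h t = (Real.Gamma a)⁻¹ • ∫ ξ in (0 : ℝ)..t, ((t - ξ) ^ (a - 1) : ℝ) • h ξ := by
  rw [rlInt, if_neg (neg_ne_zero.2 ha.ne'), neg_neg]

theorem rlInt_neg_one (h : ℝ → 𝕜) (t : ℝ) : rlInt (-1) h t = ∫ ξ in (0 : ℝ)..t, h ξ := by
  simp [rlInt_neg one_pos]

theorem rlInt_congr (s : ℝ) (ht : 0 < t) (hgh : EqOn g h (Ioc 0 t)) :
    rlInt s g t = rlInt s h t := by
  unfold rlInt
  rw [hgh ⟨ht, le_rfl⟩, intervalIntegral.integral_congr_Ioo_of_le ht.le fun ξ hξ => by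
    rw [hgh (Ioo_subset_Ioc_self hξ)]]

theorem rlInt_sub (hg : RlIntExists s g t) (hh : RlIntExists s h t) :
    rlInt s (g - h) t = rlInt s g t - rlInt s h t := by
  unfold rlInt
  split_ifs with hs
  · rfl
  · simp only [Pi.sub_apply, smul_sub, intervalIntegral.integral_sub (hg hs) (hh hs)]

theorem rlInt_mul_const (s : ℝ) (h : ℝ → 𝕜) (c : 𝕜) (t : ℝ) :
    rlInt s (fun ξ => h ξ * c) t = rlInt s h t * c := by
  unfold rlInt
  split_ifs
  · rfl
  · simp only [← smul_mul_assoc, intervalIntegral.integral_mul_const]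

theorem rlIntExists_neg_iff (ha : 0 < a) : RlIntExists (-a) h t ↔
    IntervalIntegrable (fun ξ => ((t - ξ) ^ (a - 1) : ℝ) • h ξ) volume 0 t := by
  rw [RlIntExists, neg_neg]
  exact forall_prop_of_true (neg_ne_zero.2 ha.ne')

theorem RlIntExists.sub (hg : RlIntExists s g t) (hh : RlIntExists s h t) :
    RlIntExists s (g - h) t := fun hs => by
  simpa only [Pi.sub_apply, smul_sub] using (hg hs).sub (hh hs)

theorem RlIntExists.mul_const (hh : RlIntExists s h t) (c : 𝕜) :
    RlIntExists s (fun ξ => h ξ * c) t := fun hs => by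
  simpa only [smul_mul_assoc] using IntervalIntegrable.mul_const (hh hs) c

theorem RlIntExists.of_le (ha : 0 < a) (hab : a ≤ b) (ht : 0 ≤ t) (hh : RlIntExists (-a) h t) :
    RlIntExists (-b) h t := by
  rw [rlIntExists_neg_iff ha] at hh
  rw [rlIntExists_neg_iff (ha.trans_le hab)]
  have hcont : Continuous fun ξ : ℝ => (t - ξ) ^ (b - a) :=
    (continuous_const.sub continuous_id).rpow_const fun _ => Or.inr (sub_nonneg.2 hab)
  have hprod := hh.continuousOn_smul hcont.continuousOn
  refine hprod.congr_uIoo fun ξ hξ => ?_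
  rw [uIoo_of_le ht] at hξ
  change (t - ξ) ^ (b - a) • (t - ξ) ^ (a - 1) • h ξ = _
  rw [smul_smul, ← Real.rpow_add (sub_pos.2 hξ.2), sub_add_sub_cancel]

theorem rlIntExists_neg_one_iff : RlIntExists (-1) h t ↔ IntervalIntegrable h volume 0 t := by
  simp [rlIntExists_neg_iff one_pos]

theorem RlIntExists.aestronglyMeasurable (ha : 0 < a) (hh : RlIntExists (-a) h t) :
    AEStronglyMeasurable h (volume.restrict (Ioc 0 t)) := by
  have hkernel : Measurable fun ξ : ℝ => (t - ξ) ^ (1 - a) := by fun_prop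
  have hprod := hkernel.aestronglyMeasurable.smul
    ((rlIntExists_neg_iff ha).1 hh).1.aestronglyMeasurable
  rw [← restrict_Ioo_eq_restrict_Ioc] at hprod ⊢
  refine hprod.congr ?_
  filter_upwards [ae_restrict_mem measurableSet_Ioo] with ξ hξ
  change (t - ξ) ^ (1 - a) • (t - ξ) ^ (a - 1) • h ξ = h ξ
  rw [smul_smul, ← Real.rpow_add (sub_pos.2 hξ.2), sub_add_sub_cancel, sub_self, Real.rpow_zero,
    one_smul]

theorem integrable_indicator_beta_kernel_smul (ha : 0 < a) (hb : 0 < b)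
    (hh : RlIntExists (-(a + b)) h t) :
    Integrable ({p : ℝ × ℝ | p.1 < p.2}.indicator
      (Function.uncurry fun r s => ((t - s) ^ (a - 1) * (s - r) ^ (b - 1)) • h r))
      ((volume.restrict (Ioc 0 t)).prod (volume.restrict (Ioc 0 t))) := by
  have hmem : ∀ᵐ r ∂volume.restrict (Ioc 0 t), r ∈ Ioo 0 t := by
    rw [← restrict_Ioo_eq_restrict_Ioc]
    exact ae_restrict_mem measurableSet_Ioo
  refine integrable_indicator_lt_prod ?_ ?_ ?_
  · refine AEStronglyMeasurable.smul ?_ (hh.aestronglyMeasurable (add_pos ha hb)).comp_fst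
    exact Measurable.aestronglyMeasurable (by fun_prop)
  · filter_upwards [hmem] with r hr
    exact IntervalIntegrable.smul_continuousOn
      (intervalIntegrable_sub_rpow_mul_sub_rpow ha hb hr.2) continuousOn_const
  · refine (((rlIntExists_neg_iff (add_pos ha hb)).1 hh).1.norm.const_mul
      (ProbabilityTheory.beta a b)).congr ?_
    filter_upwards [hmem] with r hr
    rw [norm_smul, Real.norm_of_nonneg (Real.rpow_nonneg (sub_nonneg.2 hr.2.le) _), ← mul_assoc,
      ← integral_sub_rpow_mul_sub_rpow ha hb hr.2, ← intervalIntegral.integral_mul_const]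
    refine intervalIntegral.integral_congr fun s hs => ?_
    rw [uIcc_of_le hr.2.le] at hs
    have hkernel : 0 ≤ (t - s) ^ (a - 1) * (s - r) ^ (b - 1) :=
      mul_nonneg (Real.rpow_nonneg (sub_nonneg.2 hs.2) _)
        (Real.rpow_nonneg (sub_nonneg.2 hs.1) _)
    rw [norm_smul, Real.norm_of_nonneg hkernel]

theorem rlInt_neg_rlInt_neg (ha : 0 < a) (hb : 0 ≤ b) (ht : 0 ≤ t)
    (hh : RlIntExists (-(a + b)) h t) :
    rlInt (-a) (rlInt (-b) h) t = rlInt (-(a + b)) h t := by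
  obtain rfl | hb := hb.eq_or_lt
  · rw [neg_zero, rlInt_zero, add_zero]
  have hab := add_pos ha hb
  have hΓa := (Real.Gamma_pos_of_pos ha).ne'
  have hΓb := (Real.Gamma_pos_of_pos hb).ne'
  have hinner : ∀ r ∈ Ioo 0 t, ∫ s in r..t, ((t - s) ^ (a - 1) * (s - r) ^ (b - 1)) • h r =
      ProbabilityTheory.beta a b • ((t - r) ^ (a + b - 1) : ℝ) • h r := fun r hr => by
    rw [intervalIntegral.integral_smul_const, integral_sub_rpow_mul_sub_rpow ha hb hr.2, mul_smul]
  calc rlInt (-a) (rlInt (-b) h) t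
      = ((Real.Gamma a)⁻¹ * (Real.Gamma b)⁻¹) • ∫ s in (0 : ℝ)..t, ∫ r in (0 : ℝ)..s,
          ((t - s) ^ (a - 1) * (s - r) ^ (b - 1)) • h r := by
        simp only [rlInt_neg ha, rlInt_neg hb, mul_smul, intervalIntegral.integral_smul,
          smul_comm _ (Real.Gamma b)⁻¹]
    _ = ((Real.Gamma a)⁻¹ * (Real.Gamma b)⁻¹) • ∫ r in (0 : ℝ)..t,
          ProbabilityTheory.beta a b • ((t - r) ^ (a + b - 1) : ℝ) • h r := by
        rw [integral_integral_swap_of_lt ht (integrable_indicator_beta_kernel_smul ha hb hh),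
          intervalIntegral.integral_congr_Ioo_of_le ht hinner]
    _ = rlInt (-(a + b)) h t := by
        rw [intervalIntegral.integral_smul, smul_smul, rlInt_neg hab, ProbabilityTheory.beta]
        congr 1
        field_simp

theorem intervalIntegrable_sub_rpow_mul_exp (ha : 0 < a) (β t : ℝ) :
    IntervalIntegrable (fun s => (t - s) ^ (a - 1) * Real.exp (-(β * (t - s)))) volume 0 t := by
  have hpow : IntervalIntegrable (fun r : ℝ => r ^ (a - 1)) volume 0 t :=
    intervalIntegral.intervalIntegrable_rpow' (by linarith)
  have hexp : IntervalIntegrable (fun r : ℝ => r ^ (a - 1) * Real.exp (-(β * r))) volume 0 t :=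
    hpow.mul_continuousOn (by fun_prop)
  simpa only [sub_self, sub_zero] using (hexp.comp_sub_left t).symm

theorem intervalIntegrable_sub_rpow (ha : 0 < a) (t : ℝ) :
    IntervalIntegrable (fun s => (t - s) ^ (a - 1)) volume 0 t := by
  simpa using intervalIntegrable_sub_rpow_mul_exp ha 0 t

theorem integral_sub_rpow_mul_exp_le {β : ℝ} (ha : 0 < a) (hβ : 0 < β) (ht : 0 ≤ t) :
    ∫ s in (0 : ℝ)..t, (t - s) ^ (a - 1) * Real.exp (-(β * (t - s))) ≤
      (1 / β) ^ a * Real.Gamma a := by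
  have hΓ := Real.integral_rpow_mul_exp_neg_mul_Ioi ha hβ
  rw [intervalIntegral.integral_comp_sub_left fun r => r ^ (a - 1) * Real.exp (-(β * r)), sub_self,
    sub_zero, ← hΓ, intervalIntegral.integral_of_le ht]
  refine setIntegral_mono_set (not_imp_comm.1 integral_undef ?_) ?_ Ioc_subset_Ioi_self.eventuallyLE
  · rw [hΓ]
    have := Real.Gamma_pos_of_pos ha
    positivity
  · filter_upwards [ae_restrict_mem measurableSet_Ioi] with r hr
    have := mem_Ioi.1 hr
    positivity

theorem norm_rlInt_neg_le {β D : ℝ} (ha : 0 < a) (hβ : 0 < β) (ht : 0 < t)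
    (hh : ∀ s ∈ Ioc 0 t, ‖h s‖ ≤ D * Real.exp (β * s)) :
    ‖rlInt (-a) h t‖ ≤ (1 / β) ^ a * (D * Real.exp (β * t)) := by
  have hΓ := Real.Gamma_pos_of_pos ha
  have hD : 0 ≤ D * Real.exp (β * t) := (norm_nonneg _).trans (hh t ⟨ht, le_rfl⟩)
  have hbound : ‖∫ s in (0 : ℝ)..t, ((t - s) ^ (a - 1) : ℝ) • h s‖ ≤
      (1 / β) ^ a * Real.Gamma a * (D * Real.exp (β * t)) := by
    calc ‖∫ s in (0 : ℝ)..t, ((t - s) ^ (a - 1) : ℝ) • h s‖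
        ≤ ∫ s in (0 : ℝ)..t,
            (t - s) ^ (a - 1) * Real.exp (-(β * (t - s))) * (D * Real.exp (β * t)) := by
          refine intervalIntegral.norm_integral_le_of_norm_le ht.le (.of_forall fun s hs => ?_)
            ((intervalIntegrable_sub_rpow_mul_exp ha β t).mul_const _)
          have hpow : 0 ≤ (t - s) ^ (a - 1) := Real.rpow_nonneg (sub_nonneg.2 hs.2) _
          have hexp : Real.exp (β * s) = Real.exp (-(β * (t - s))) * Real.exp (β * t) := by
            rw [← Real.exp_add]
            ring_nf
          calc ‖((t - s) ^ (a - 1) : ℝ) • h s‖ = (t - s) ^ (a - 1) * ‖h s‖ := by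
                rw [norm_smul, Real.norm_of_nonneg hpow]
            _ ≤ (t - s) ^ (a - 1) * (D * Real.exp (β * s)) := by gcongr; exact hh s hs
            _ = _ := by rw [hexp]; ring
      _ ≤ (1 / β) ^ a * Real.Gamma a * (D * Real.exp (β * t)) := by
          rw [intervalIntegral.integral_mul_const]
          gcongr
          exact integral_sub_rpow_mul_exp_le ha hβ ht.le
  calc ‖rlInt (-a) h t‖
      = (Real.Gamma a)⁻¹ * ‖∫ s in (0 : ℝ)..t, ((t - s) ^ (a - 1) : ℝ) • h s‖ := by
        rw [rlInt_neg ha, norm_smul, norm_inv, Real.norm_of_nonneg hΓ.le]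
    _ ≤ (Real.Gamma a)⁻¹ * ((1 / β) ^ a * Real.Gamma a * (D * Real.exp (β * t))) := by gcongr
    _ = (1 / β) ^ a * (D * Real.exp (β * t)) := by field_simp

theorem tendsto_rlInt_neg_zero {M R : ℝ} (ha : 0 < a) (hR : 0 < R)
    (hh : ∀ s ∈ Ioc 0 R, ‖h s‖ ≤ M) : Tendsto (rlInt (-a) h) (𝓝[>] 0) (𝓝 0) := by
  have hM : 0 ≤ M := (norm_nonneg _).trans (hh R ⟨hR, le_rfl⟩)
  have hlim : Tendsto (fun t : ℝ => t ^ a * (M * Real.exp 1)) (𝓝[>] 0) (𝓝 0) := by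
    have := ((Real.continuous_rpow_const ha.le).tendsto 0).mul_const (M * Real.exp 1)
    rw [Real.zero_rpow ha.ne', zero_mul] at this
    exact this.mono_left nhdsWithin_le_nhds
  refine squeeze_zero_norm' ?_ hlim
  filter_upwards [Ioc_mem_nhdsGT hR] with t ht
  -- The weight `exp (s / t)` keeps the exponential factor bounded on `(0, t]`.
  have := norm_rlInt_neg_le (D := M) ha (inv_pos.2 ht.1) ht.1 fun s hs =>
    (hh s ⟨hs.1, hs.2.trans ht.2⟩).trans <| le_mul_of_one_le_right hM <|
      Real.one_le_exp (mul_nonneg (inv_nonneg.2 ht.1.le) hs.1.le)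
  rwa [one_div, inv_inv, inv_mul_cancel₀ ht.1.ne'] at this

theorem exists_one_div_rpow_eq {q : ℝ} (ha : 0 < a) (hq : 0 < q) : ∃ β > 0, (1 / β) ^ a = q :=
  ⟨(q ^ a⁻¹)⁻¹, by positivity, by
    rw [one_div, inv_inv, ← Real.rpow_mul hq.le, inv_mul_cancel₀ ha.ne', Real.rpow_one]⟩

theorem eq_zero_of_norm_le_norm_rlInt {c M R : ℝ} (ha : 0 < a) (hM : ∀ t ∈ Ioc 0 R, ‖h t‖ ≤ M)
    (hh : ∀ t ∈ Ioc 0 R, ‖h t‖ ≤ c * ‖rlInt (-a) h t‖) : ∀ t ∈ Ioc 0 R, h t = 0 := by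
  -- With `c (1 / β) ^ a ≤ 1 / 2`, each use of `hh` halves the norm weighted by `exp (-β t)`.
  obtain ⟨β, hβ, hβq⟩ := exists_one_div_rpow_eq ha (q := (2 * (|c| + 1))⁻¹) (by positivity)
  have hcβ : |c| * (1 / β) ^ a ≤ 1 / 2 := by
    rw [hβq, ← div_eq_mul_inv, div_le_iff₀ (by positivity)]
    linarith
  have hdecay : ∀ n : ℕ, ∀ t ∈ Ioc 0 R, ‖h t‖ ≤ |M| * (1 / 2) ^ n * Real.exp (β * t) := by
    intro n
    induction n with
    | zero =>
      intro t ht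
      rw [pow_zero, mul_one]
      exact ((hM t ht).trans (le_abs_self M)).trans
        (le_mul_of_one_le_right (abs_nonneg M) (Real.one_le_exp (mul_nonneg hβ.le ht.1.le)))
    | succ n ih =>
      intro t ht
      have hrl := norm_rlInt_neg_le ha hβ ht.1 fun s hs => ih s ⟨hs.1, hs.2.trans ht.2⟩
      calc ‖h t‖ ≤ |c| * ‖rlInt (-a) h t‖ := (hh t ht).trans (by gcongr; exact le_abs_self c)
        _ ≤ |c| * ((1 / β) ^ a * (|M| * (1 / 2) ^ n * Real.exp (β * t))) := by gcongr
        _ = |c| * (1 / β) ^ a * (|M| * (1 / 2) ^ n * Real.exp (β * t)) := by ring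
        _ ≤ 1 / 2 * (|M| * (1 / 2) ^ n * Real.exp (β * t)) := by gcongr
        _ = |M| * (1 / 2) ^ (n + 1) * Real.exp (β * t) := by ring
  intro t ht
  have hlim : Tendsto (fun n : ℕ => |M| * (1 / 2 : ℝ) ^ n * Real.exp (β * t)) atTop (𝓝 0) := by
    simpa using ((tendsto_pow_atTop_nhds_zero_of_lt_one (r := (1 / 2 : ℝ)) (by norm_num)
      (by norm_num)).const_mul |M|).mul_const (Real.exp (β * t))
  exact norm_le_zero_iff.1 (ge_of_tendsto' hlim fun n => hdecay n t ht)

end RiemannLiouville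

section Fubini

theorem aestronglyMeasurable_comp_simpleFunc {X α β : Type*} [MeasurableSpace X]
    [MeasurableSpace α] [TopologicalSpace β] [TopologicalSpace.PseudoMetrizableSpace β]
    {μ : Measure X} {ν : Measure α} {F : α → X → β} (p : SimpleFunc X X)
    (hF : ∀ x, AEStronglyMeasurable (fun a => F a (p x)) ν) :
    AEStronglyMeasurable (fun z : α × X => F z.1 (p z.2)) (ν.prod μ) := by
  have hcover : ⋃ c : p.range, (fun z : α × X => p z.2) ⁻¹' {(c : X)} = univ :=
    iUnion_eq_univ_iff.2 fun z => ⟨⟨p z.2, p.mem_range_self z.2⟩, rfl⟩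
  rw [← Measure.restrict_univ (μ := ν.prod μ), ← hcover, aestronglyMeasurable_iUnion_iff]
  rintro ⟨c, hc⟩
  obtain ⟨x, rfl⟩ := SimpleFunc.mem_range.1 hc
  refine ((hF x).comp_fst.mono_measure Measure.restrict_le_self).congr ?_
  have hmeas : MeasurableSet ((fun z : α × X => p z.2) ⁻¹' {p x}) :=
    measurable_snd (p.measurableSet_fiber (p x))
  filter_upwards [ae_restrict_mem hmeas] with z hz
  rw [show p z.2 = p x from hz]

theorem aestronglyMeasurable_uncurry_of_continuousOn {X α β : Type*} [PseudoEMetricSpace X]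
    [SecondCountableTopology X] [MeasurableSpace X] [OpensMeasurableSpace X] [MeasurableSpace α]
    [TopologicalSpace β] [TopologicalSpace.PseudoMetrizableSpace β] {μ : Measure X}
    {ν : Measure α} {S : Set X} (hS : MeasurableSet S) {F : α → X → β}
    (hc : ∀ᵐ a ∂ν, ContinuousOn (F a) S) (hm : ∀ x ∈ S, AEStronglyMeasurable (fun a => F a x) ν) :
    AEStronglyMeasurable (Function.uncurry F) (ν.prod (μ.restrict S)) := by
  obtain rfl | ⟨x₀, hx₀⟩ := S.eq_empty_or_nonempty
  · simp
  refine aestronglyMeasurable_of_tendsto_ae atTop (fun n => aestronglyMeasurable_comp_simpleFunc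
    (SimpleFunc.approxOn id measurable_id S x₀ hx₀ n)
    fun x => hm _ (SimpleFunc.approxOn_mem measurable_id hx₀ n x)) ?_
  filter_upwards [Measure.quasiMeasurePreserving_fst.ae hc,
    Measure.quasiMeasurePreserving_snd.ae (ae_restrict_mem hS)] with z hz hzS
  refine (hz z.2 hzS).tendsto.comp (tendsto_nhdsWithin_iff.2 ⟨?_, .of_forall fun n =>
    SimpleFunc.approxOn_mem measurable_id hx₀ n z.2⟩)
  exact SimpleFunc.tendsto_approxOn measurable_id hx₀ (subset_closure hzS)

theorem isFiniteMeasure_restrict_of_isCompact_closure {X : Type*} [TopologicalSpace X]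
    [MeasurableSpace X] {μ : Measure X} [IsFiniteMeasureOnCompacts μ] {Ω : Set X}
    (hΩ : IsCompact (closure Ω)) : IsFiniteMeasure (μ.restrict Ω) :=
  isFiniteMeasure_restrict.2 ((measure_mono subset_closure).trans_lt hΩ.measure_lt_top).ne

variable {X E : Type*} [MetricSpace X] [MeasurableSpace X] [OpensMeasurableSpace X]
  [NormedAddCommGroup E] {μ : Measure X} [IsFiniteMeasureOnCompacts μ] {Ω : Set X}

theorem integrableOn_of_continuousOn_closure (hΩ : IsCompact (closure Ω)) {g : X → E}
    (hg : ContinuousOn g (closure Ω)) : IntegrableOn g Ω μ :=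
  (hg.integrableOn_compact hΩ).mono_set subset_closure

theorem continuousOn_setIntegral [NormedSpace ℝ E] {Y : Type*} [TopologicalSpace Y]
    [FirstCountableTopology Y] (hΩm : MeasurableSet Ω) (hΩ : IsCompact (closure Ω)) {I : Set Y}
    (hI : IsCompact I) {F : X → Y → E}
    (hF : ContinuousOn (Function.uncurry F) (closure Ω ×ˢ I)) :
    ContinuousOn (fun t => ∫ x in Ω, F x t ∂μ) I := by
  obtain ⟨M, hM⟩ := (hΩ.prod hI).exists_bound_of_continuousOn hF
  refine continuousOn_of_dominated (bound := fun _ => M) (fun t ht => ?_) (fun t ht => ?_) ?_ ?_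
  · exact (integrableOn_of_continuousOn_closure hΩ
      (hF.uncurry_right t ht)).aestronglyMeasurable
  · filter_upwards [ae_restrict_mem hΩm] with x hx using hM (x, t) ⟨subset_closure hx, ht⟩
  · exact integrableOn_of_continuousOn_closure hΩ continuousOn_const
  · filter_upwards [ae_restrict_mem hΩm] with x hx using hF.uncurry_left x (subset_closure hx)

variable [SecondCountableTopology X] {a b : ℝ}

theorem integrable_uncurry_smul_of_continuousOn [NormedSpace ℝ E] (hΩm : MeasurableSet Ω)
    (hΩ : IsCompact (closure Ω)) {k : ℝ → ℝ} (hk : IntervalIntegrable k volume a b)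
    {Φ : X → ℝ → E} (hΦ : ContinuousOn (Function.uncurry Φ) (closure Ω ×ˢ uIcc a b)) :
    Integrable (Function.uncurry fun s x => k s • Φ x s)
      ((volume.restrict (uIoc a b)).prod (μ.restrict Ω)) := by
  have hfin := isFiniteMeasure_restrict_of_isCompact_closure (μ := μ) hΩ
  obtain ⟨M, hM⟩ := (hΩ.prod isCompact_uIcc).exists_bound_of_continuousOn hΦ
  have hmeas : AEStronglyMeasurable (Function.uncurry fun s x => Φ x s)
      ((volume.restrict (uIoc a b)).prod (μ.restrict Ω)) := by
    refine aestronglyMeasurable_uncurry_of_continuousOn hΩm ?_ fun x hx =>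
      ((hΦ.uncurry_left x (subset_closure hx)).mono uIoc_subset_uIcc).aestronglyMeasurable
        measurableSet_uIoc
    filter_upwards [ae_restrict_mem measurableSet_uIoc] with s hs using
      (hΦ.uncurry_right s (uIoc_subset_uIcc hs)).mono subset_closure
  refine (hk.def'.comp_fst (μ.restrict Ω)).smul_bdd M hmeas ?_
  filter_upwards [Measure.quasiMeasurePreserving_fst.ae (ae_restrict_mem measurableSet_uIoc),
    Measure.quasiMeasurePreserving_snd.ae (ae_restrict_mem hΩm)] with p hs hx using
    hM (p.2, p.1) ⟨subset_closure hx, uIoc_subset_uIcc hs⟩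

theorem integrable_uncurry_of_setIntegral_norm_le (hΩm : MeasurableSet Ω)
    (hΩ : IsCompact (closure Ω)) {w : X → ℝ → E}
    (hc : ∀ s ∈ uIoc a b, ContinuousOn (fun x => w x s) (closure Ω))
    (hm : ∀ x ∈ Ω, IntervalIntegrable (w x) volume a b) {C : ℝ}
    (hC : ∀ s ∈ uIoc a b, ∫ x in Ω, ‖w x s‖ ∂μ ≤ C) :
    Integrable (Function.uncurry fun s x => w x s)
      ((volume.restrict (uIoc a b)).prod (μ.restrict Ω)) := by
  have hfin := isFiniteMeasure_restrict_of_isCompact_closure (μ := μ) hΩ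
  have hfin' : IsFiniteMeasure (volume.restrict (uIoc a b)) :=
    isFiniteMeasure_restrict_of_isCompact_closure
      (isCompact_uIcc.closure_of_subset uIoc_subset_uIcc)
  have hmem : ∀ᵐ s ∂volume.restrict (uIoc a b), s ∈ uIoc a b := ae_restrict_mem measurableSet_uIoc
  have hmeas : AEStronglyMeasurable (Function.uncurry fun s x => w x s)
      ((volume.restrict (uIoc a b)).prod (μ.restrict Ω)) := by
    refine aestronglyMeasurable_uncurry_of_continuousOn hΩm ?_ fun x hx =>
      (hm x hx).def'.aestronglyMeasurable
    filter_upwards [hmem] with s hs using (hc s hs).mono subset_closure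
  refine (integrable_prod_iff hmeas).2 ⟨?_, .of_bound hmeas.norm.integral_prod_right' C ?_⟩
  · filter_upwards [hmem] with s hs using integrableOn_of_continuousOn_closure hΩ (hc s hs)
  · filter_upwards [hmem] with s hs
    rw [Real.norm_of_nonneg (integral_nonneg fun x => norm_nonneg _)]
    exact hC s hs

end Fubini

section Coefficient

section Measure

variable {𝕜 : Type} [RCLike 𝕜] {X : Type*} [MetricSpace X] [SecondCountableTopology X]
  [MeasurableSpace X] [OpensMeasurableSpace X] {μ : Measure X} [IsFiniteMeasureOnCompacts μ]
  {Ω : Set X} {a t : ℝ} {F : X → ℝ → 𝕜}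

theorem integrableOn_rlInt_neg (ha : 0 < a) (hΩm : MeasurableSet Ω) (hΩ : IsCompact (closure Ω))
    (hF : ContinuousOn (Function.uncurry F) (closure Ω ×ˢ uIcc 0 t)) :
    IntegrableOn (fun x => rlInt (-a) (F x) t) Ω μ := by
  have hfin := isFiniteMeasure_restrict_of_isCompact_closure (μ := μ) hΩ
  have hint := (integrable_uncurry_smul_of_continuousOn (μ := μ) hΩm hΩ
    (intervalIntegrable_sub_rpow ha t) hF).integral_prod_right
  simp only [rlInt_neg ha, intervalIntegral.intervalIntegral_eq_integral_uIoc]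
  exact (hint.smul (_ : ℝ)).smul (Real.Gamma a)⁻¹

theorem rlInt_neg_setIntegral (ha : 0 < a) (hΩm : MeasurableSet Ω) (hΩ : IsCompact (closure Ω))
    (hF : ContinuousOn (Function.uncurry F) (closure Ω ×ˢ uIcc 0 t)) :
    rlInt (-a) (fun s => ∫ x in Ω, F x s ∂μ) t = ∫ x in Ω, rlInt (-a) (F x) t ∂μ := by
  have hfin := isFiniteMeasure_restrict_of_isCompact_closure (μ := μ) hΩ
  simp only [rlInt_neg ha, integral_smul, ← intervalIntegral_integral_swap
    (integrable_uncurry_smul_of_continuousOn hΩm hΩ (intervalIntegrable_sub_rpow ha t) hF)]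

end Measure

/-- `H = ∂_t^{ρ-1} u` and `G = ∂_t^ρ u` on `Ω × (0,∞)`, with `H` continuous up to `t = 0`, where it
vanishes, and `u(·,t)`, `H`, `G` continuous up to the boundary of `Ω`. This is the part of the
definition of a regular solution of the homogeneous problem that refers to the time variable; it is
stable under multiplication by functions of `x`. -/
structure HasRLDerivOn {𝕜 : Type} [RCLike 𝕜] {X : Type*} [TopologicalSpace X] (Ω : Set X) (ρ : ℝ)
    (u H G : X → ℝ → 𝕜) : Prop where
  continuousOn : ∀ t > 0, ContinuousOn (fun x => u x t) (closure Ω)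
  rlIntExists : ∀ x ∈ Ω, ∀ t > 0, RlIntExists (ρ - 1) (u x) t
  rlInt_eq : ∀ x ∈ Ω, ∀ t > 0, rlInt (ρ - 1) (u x) t = H x t
  hasDerivAt : ∀ x ∈ Ω, ∀ t > 0, HasDerivAt (H x) (G x t) t
  continuousOn_rlInt : ContinuousOn (Function.uncurry H) (closure Ω ×ˢ Ici 0)
  continuousOn_rlDeriv : ContinuousOn (Function.uncurry G) (closure Ω ×ˢ Ioi 0)
  initial : ∀ x ∈ Ω, H x 0 = 0

namespace HasRLDerivOn

variable {𝕜 : Type} [RCLike 𝕜] {ρ ε t : ℝ}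

section Topological

variable {X : Type*} [TopologicalSpace X] {Ω : Set X} {u H G : X → ℝ → 𝕜} {x : X}

theorem mul_right (h : HasRLDerivOn Ω ρ u H G) {ψ : X → 𝕜} (hψ : ContinuousOn ψ (closure Ω)) :
    HasRLDerivOn Ω ρ (fun x t => u x t * ψ x) (fun x t => H x t * ψ x)
      (fun x t => G x t * ψ x) where
  continuousOn t ht := (h.continuousOn t ht).mul hψ
  rlIntExists x hx t ht := (h.rlIntExists x hx t ht).mul_const (ψ x)
  rlInt_eq x hx t ht := by rw [rlInt_mul_const, h.rlInt_eq x hx t ht]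
  hasDerivAt x hx t ht := (h.hasDerivAt x hx t ht).mul_const (ψ x)
  continuousOn_rlInt := h.continuousOn_rlInt.mul (hψ.comp continuousOn_fst fun _ hp => hp.1)
  continuousOn_rlDeriv := h.continuousOn_rlDeriv.mul (hψ.comp continuousOn_fst fun _ hp => hp.1)
  initial x hx := by rw [h.initial x hx, zero_mul]

theorem continuousOn_rlInt_time (h : HasRLDerivOn Ω ρ u H G) (hx : x ∈ Ω) :
    ContinuousOn (H x) (Ici 0) :=
  h.continuousOn_rlInt.uncurry_left x (subset_closure hx)

theorem intervalIntegrable (h : HasRLDerivOn Ω ρ u H G) (hρ₀ : 0 < ρ) (hρ₁ : ρ ≤ 1) (hx : x ∈ Ω)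
    (ht : 0 < t) : IntervalIntegrable (u x) volume 0 t := by
  obtain rfl | hρ := hρ₁.eq_or_lt
  · have hH : IntervalIntegrable (H x) volume 0 t :=
      ((h.continuousOn_rlInt_time hx).mono (by
        rw [uIcc_of_le ht.le]; exact Icc_subset_Ici_self)).intervalIntegrable
    refine hH.congr fun s hs => ?_
    rw [uIoc_of_le ht.le] at hs
    rw [← h.rlInt_eq x hx s hs.1, sub_self, rlInt_zero]
  · have hex := h.rlIntExists x hx t ht
    rw [← neg_sub] at hex
    exact rlIntExists_neg_one_iff.1 (hex.of_le (sub_pos.2 hρ) (sub_le_self 1 hρ₀.le) ht.le)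

theorem rlInt_neg_rlInt (h : HasRLDerivOn Ω ρ u H G) (hρ₀ : 0 < ρ) (hρ₁ : ρ ≤ 1) (hx : x ∈ Ω)
    (ht : 0 < t) : rlInt (-ρ) (H x) t = ∫ s in (0 : ℝ)..t, u x s := by
  have hex : RlIntExists (-(ρ + (1 - ρ))) (u x) t := by
    rw [add_sub_cancel, rlIntExists_neg_one_iff]
    exact h.intervalIntegrable hρ₀ hρ₁ hx ht
  calc rlInt (-ρ) (H x) t = rlInt (-ρ) (rlInt (-(1 - ρ)) (u x)) t :=
        rlInt_congr _ ht fun s hs => by rw [neg_sub, h.rlInt_eq x hx s hs.1]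
    _ = rlInt (-(ρ + (1 - ρ))) (u x) t :=
        rlInt_neg_rlInt_neg hρ₀ (sub_nonneg.2 hρ₁) ht.le hex
    _ = ∫ s in (0 : ℝ)..t, u x s := by rw [add_sub_cancel, rlInt_neg_one]

theorem integral_rlDeriv (h : HasRLDerivOn Ω ρ u H G) (hx : x ∈ Ω) (hε : 0 < ε) (ht : 0 < t) :
    ∫ s in ε..t, G x s = H x t - H x ε := by
  have hpos : uIcc ε t ⊆ Ioi 0 := fun s hs => (lt_min hε ht).trans_le hs.1
  exact intervalIntegral.integral_eq_sub_of_hasDerivAt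
    (fun s hs => h.hasDerivAt x hx s (hpos hs))
    ((h.continuousOn_rlDeriv.uncurry_left x (subset_closure hx)).mono hpos).intervalIntegrable

end Topological

section Measurable

variable {X : Type*} [MetricSpace X] [MeasurableSpace X] [OpensMeasurableSpace X]
  {μ : Measure X} [IsFiniteMeasureOnCompacts μ] {Ω : Set X} {u H G : X → ℝ → 𝕜} {R M : ℝ}

theorem integrableOn_rlInt (h : HasRLDerivOn Ω ρ u H G) (hΩ : IsCompact (closure Ω))
    (ht : 0 ≤ t) : IntegrableOn (fun x => H x t) Ω μ :=
  integrableOn_of_continuousOn_closure hΩ (h.continuousOn_rlInt.uncurry_right t ht)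

theorem continuousOn_setIntegral_rlInt (h : HasRLDerivOn Ω ρ u H G) (hΩm : MeasurableSet Ω)
    (hΩ : IsCompact (closure Ω)) (R : ℝ) :
    ContinuousOn (fun t => ∫ x in Ω, H x t ∂μ) (Icc 0 R) :=
  continuousOn_setIntegral hΩm hΩ isCompact_Icc
    (h.continuousOn_rlInt.mono (prod_mono le_rfl Icc_subset_Ici_self))

theorem tendsto_setIntegral_rlInt (h : HasRLDerivOn Ω ρ u H G) (hΩm : MeasurableSet Ω)
    (hΩ : IsCompact (closure Ω)) :
    Tendsto (fun t => ∫ x in Ω, H x t ∂μ) (𝓝[>] 0) (𝓝 0) := by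
  have hinit : ∫ x in Ω, H x 0 ∂μ = 0 := setIntegral_eq_zero_of_forall_eq_zero h.initial
  have hcont := h.continuousOn_setIntegral_rlInt (μ := μ) hΩm hΩ 1 0 ⟨le_rfl, zero_le_one⟩
  rw [ContinuousWithinAt, hinit] at hcont
  exact hcont.mono_left (nhdsWithin_le_of_mem (Icc_mem_nhdsGT zero_lt_one))

variable [SecondCountableTopology X]

theorem integral_setIntegral_rlDeriv (h : HasRLDerivOn Ω ρ u H G) (hΩm : MeasurableSet Ω)
    (hΩ : IsCompact (closure Ω)) (hε : 0 < ε) (ht : 0 < t) :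
    ∫ s in ε..t, (∫ x in Ω, G x s ∂μ) = (∫ x in Ω, H x t ∂μ) - ∫ x in Ω, H x ε ∂μ := by
  have hfin := isFiniteMeasure_restrict_of_isCompact_closure (μ := μ) hΩ
  have hpos : uIcc ε t ⊆ Ioi 0 := fun s hs => (lt_min hε ht).trans_le hs.1
  have hG := integrable_uncurry_smul_of_continuousOn (μ := μ) hΩm hΩ
    (intervalIntegrable_const (c := (1 : ℝ)))
    (h.continuousOn_rlDeriv.mono (prod_mono le_rfl hpos))
  simp only [one_smul] at hG
  rw [intervalIntegral_integral_swap hG,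
    setIntegral_congr_fun hΩm fun x hx => h.integral_rlDeriv hx hε ht,
    integral_sub (h.integrableOn_rlInt hΩ ht.le) (h.integrableOn_rlInt hΩ hε.le)]

theorem rlInt_neg_setIntegral_rlInt_sub (h : HasRLDerivOn Ω ρ u H G) (hΩm : MeasurableSet Ω)
    (hΩ : IsCompact (closure Ω)) (hρ₀ : 0 < ρ) (hρ₁ : ρ ≤ 1) (hε : 0 < ε) (ht : 0 < t) {C : ℝ}
    (hC : ∀ s ∈ uIoc ε t, ∫ x in Ω, ‖u x s‖ ∂μ ≤ C) :
    rlInt (-ρ) (fun s => ∫ x in Ω, H x s ∂μ) t - rlInt (-ρ) (fun s => ∫ x in Ω, H x s ∂μ) ε =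
      ∫ s in ε..t, (∫ x in Ω, u x s ∂μ) := by
  have hfin := isFiniteMeasure_restrict_of_isCompact_closure (μ := μ) hΩ
  have hu : ∀ x ∈ Ω, ∀ {s}, 0 < s → IntervalIntegrable (u x) volume 0 s := fun x hx _ hs =>
    h.intervalIntegrable hρ₀ hρ₁ hx hs
  have hprod : Integrable (Function.uncurry fun s x => u x s)
      ((volume.restrict (uIoc ε t)).prod (μ.restrict Ω)) :=
    integrable_uncurry_of_setIntegral_norm_le hΩm hΩ
      (fun s hs => h.continuousOn s ((lt_min hε ht).trans hs.1))
      (fun x hx => (hu x hx hε).symm.trans (hu x hx ht)) hC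
  have hH : ∀ {s}, 0 < s → ContinuousOn (Function.uncurry H) (closure Ω ×ˢ uIcc 0 s) := fun hs =>
    h.continuousOn_rlInt.mono (prod_mono le_rfl (by
      rw [uIcc_of_le hs.le]; exact Icc_subset_Ici_self))
  rw [rlInt_neg_setIntegral hρ₀ hΩm hΩ (hH ht), rlInt_neg_setIntegral hρ₀ hΩm hΩ (hH hε),
    ← integral_sub (integrableOn_rlInt_neg hρ₀ hΩm hΩ (hH ht))
      (integrableOn_rlInt_neg hρ₀ hΩm hΩ (hH hε)), intervalIntegral_integral_swap hprod]
  refine setIntegral_congr_fun hΩm fun x hx => ?_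
  simp only [h.rlInt_neg_rlInt hρ₀ hρ₁ hx ht, h.rlInt_neg_rlInt hρ₀ hρ₁ hx hε]
  exact intervalIntegral.integral_interval_sub_left (hu x hx ht) (hu x hx hε)

theorem rlInt_neg_setIntegral_rlInt_eq_mul {κ : 𝕜} (h : HasRLDerivOn Ω ρ u H G)
    (hΩm : MeasurableSet Ω) (hΩ : IsCompact (closure Ω)) (hρ₀ : 0 < ρ) (hρ₁ : ρ ≤ 1)
    (hu : ∀ ε > 0, ∀ R, ∃ C, ∀ s ∈ Icc ε R, ∫ x in Ω, ‖u x s‖ ∂μ ≤ C)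
    (huG : ∀ t > 0, ∫ x in Ω, u x t ∂μ = κ * ∫ x in Ω, G x t ∂μ) (ht : 0 < t) :
    rlInt (-ρ) (fun s => ∫ x in Ω, H x s ∂μ) t = κ * ∫ x in Ω, H x t ∂μ := by
  set J : ℝ → 𝕜 := fun s => ∫ x in Ω, H x s ∂μ
  have hdiff : ∀ ε ∈ Ioo 0 t, rlInt (-ρ) J t - rlInt (-ρ) J ε = κ * (J t - J ε) := fun ε hε => by
    obtain ⟨C, hC⟩ := hu ε hε.1 t
    rw [h.rlInt_neg_setIntegral_rlInt_sub hΩm hΩ hρ₀ hρ₁ hε.1 ht fun s hs =>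
        hC s (by rw [uIoc_of_le hε.2.le] at hs; exact Ioc_subset_Icc_self hs),
      ← h.integral_setIntegral_rlDeriv hΩm hΩ hε.1 ht, ← intervalIntegral.integral_const_mul]
    exact intervalIntegral.integral_congr fun s hs =>
      huG s ((lt_min hε.1 ht).trans_le hs.1)
  obtain ⟨M, hM⟩ := isCompact_Icc.exists_bound_of_continuousOn
    (h.continuousOn_setIntegral_rlInt (μ := μ) hΩm hΩ 1)
  have hleft : Tendsto (fun ε => rlInt (-ρ) J t - rlInt (-ρ) J ε) (𝓝[>] 0)
      (𝓝 (rlInt (-ρ) J t)) := by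
    simpa using (tendsto_rlInt_neg_zero hρ₀ one_pos
      fun s hs => hM s (Ioc_subset_Icc_self hs)).const_sub (rlInt (-ρ) J t)
  have hright : Tendsto (fun ε => κ * (J t - J ε)) (𝓝[>] 0) (𝓝 (κ * J t)) := by
    simpa using ((h.tendsto_setIntegral_rlInt (μ := μ) hΩm hΩ).const_sub (J t)).const_mul κ
  refine tendsto_nhds_unique_of_eventuallyEq hleft hright ?_
  filter_upwards [Ioo_mem_nhdsGT ht] with ε hε using hdiff ε hε

theorem setIntegral_rlInt_eq_zero {κ : 𝕜} (h : HasRLDerivOn Ω ρ u H G)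
    (hΩm : MeasurableSet Ω) (hΩ : IsCompact (closure Ω)) (hρ₀ : 0 < ρ) (hρ₁ : ρ ≤ 1)
    (hu : ∀ ε > 0, ∀ R, ∃ C, ∀ s ∈ Icc ε R, ∫ x in Ω, ‖u x s‖ ∂μ ≤ C) (hκ : κ ≠ 0)
    (huG : ∀ t > 0, ∫ x in Ω, u x t ∂μ = κ * ∫ x in Ω, G x t ∂μ) (ht : 0 < t) :
    ∫ x in Ω, H x t ∂μ = 0 := by
  obtain ⟨M, hM⟩ := isCompact_Icc.exists_bound_of_continuousOn
    (h.continuousOn_setIntegral_rlInt (μ := μ) hΩm hΩ t)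
  refine eq_zero_of_norm_le_norm_rlInt (h := fun s => ∫ x in Ω, H x s ∂μ) (c := ‖κ‖⁻¹) hρ₀
    (fun s hs => hM s (Ioc_subset_Icc_self hs)) (fun s hs => ?_) t ⟨ht, le_rfl⟩
  rw [h.rlInt_neg_setIntegral_rlInt_eq_mul hΩm hΩ hρ₀ hρ₁ hu huG hs.1, norm_mul,
    inv_mul_cancel_left₀ (norm_ne_zero_iff.2 hκ)]

end Measurable

end HasRLDerivOn

end Coefficient

section L2

theorem inner_apply_eq_mul_inner_of_hilbertBasis {𝕜 E ι : Type*} [RCLike 𝕜]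
    [NormedAddCommGroup E] [InnerProductSpace 𝕜 E] (V : HilbertBasis ι 𝕜 E) {T : E →L[𝕜] E}
    {c : ι → 𝕜} (hT : ∀ k, T (V k) = c k • V k) (k : ι) (F : E) :
    inner 𝕜 (V k) (T F) = c k * inner 𝕜 (V k) F := by
  have hcomp : (innerSL 𝕜 (V k)).comp T = c k • innerSL 𝕜 (V k) := by
    refine ContinuousLinearMap.ext_on
      (Submodule.dense_iff_topologicalClosure_eq_top.2 V.dense_span) ?_
    rintro _ ⟨j, rfl⟩
    obtain rfl | hjk := eq_or_ne k j
    · simp [hT]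
    · simp [hT, V.orthonormal.inner_eq_zero hjk]
  exact congrArg (fun Φ : E →L[𝕜] 𝕜 => Φ F) hcomp

theorem eq_zero_of_forall_inner_hilbertBasis_eq_zero {𝕜 E ι : Type*} [RCLike 𝕜]
    [NormedAddCommGroup E] [InnerProductSpace 𝕜 E] (V : HilbertBasis ι 𝕜 E) {F : E}
    (hF : ∀ k, inner 𝕜 (V k) F = 0) : F = 0 :=
  V.repr.map_eq_zero_iff.1 <| lp.ext <| funext fun k => by rw [V.repr_apply_apply, hF k]; rfl

section Measure

variable {𝕜 X : Type*} [RCLike 𝕜] [MeasurableSpace X] {ν : Measure X} {f g : X → 𝕜}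
  {F G : Lp 𝕜 2 ν}

theorem inner_eq_integral_mul_star (hF : F =ᵐ[ν] f) (hG : G =ᵐ[ν] g) :
    inner 𝕜 F G = ∫ x, g x * star (f x) ∂ν := by
  rw [L2.inner_def]
  refine integral_congr_ae ?_
  filter_upwards [hF, hG] with x hFx hGx
  rw [hFx, hGx, RCLike.inner_apply, starRingEnd_apply]

theorem integral_norm_mul_le (hF : F =ᵐ[ν] f) (hG : G =ᵐ[ν] g) :
    ∫ x, ‖f x * g x‖ ∂ν ≤ ‖F‖ * ‖G‖ := by
  have hmul : (F • G : Lp 𝕜 1 ν) =ᵐ[ν] fun x => f x * g x := by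
    filter_upwards [Lp.coeFn_lpSMul (r := 1) F G, hF, hG] with x hx hFx hGx
    rw [hx, Pi.smul_apply', hFx, hGx, smul_eq_mul]
  calc ∫ x, ‖f x * g x‖ ∂ν = ‖(F • G : Lp 𝕜 1 ν)‖ := by
        rw [L1.norm_eq_integral_norm]
        exact integral_congr_ae (hmul.fun_comp norm).symm
    _ ≤ ‖F‖ * ‖G‖ := Lp.norm_smul_le F G

/-- The operator `S` on `L₂(ν)` sends the class of the function `f` to the class of `g`. It allows
to apply `S` to functions that are known pointwise; it says nothing if `f` or `g` is not square
integrable. -/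
def LpMapsTo (S : Lp 𝕜 2 ν →L[𝕜] Lp 𝕜 2 ν) (f g : X → 𝕜) : Prop :=
  ∀ F G : Lp 𝕜 2 ν, F =ᵐ[ν] f → G =ᵐ[ν] g → S F = G

end Measure

section Topological

variable {X E : Type*} [MeasurableSpace X] [NormedAddCommGroup E] {μ : Measure X} {Ω : Set X}
  {g : X → E}

theorem exists_Lp_ae_eq_of_continuousOn_closure [MetricSpace X] [OpensMeasurableSpace X]
    [IsFiniteMeasureOnCompacts μ] (hΩm : MeasurableSet Ω)
    (hΩ : IsCompact (closure Ω)) (hg : ContinuousOn g (closure Ω)) (p : ENNReal) :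
    ∃ F : Lp E p (μ.restrict Ω), F =ᵐ[μ.restrict Ω] g := by
  have hfin := isFiniteMeasure_restrict_of_isCompact_closure (μ := μ) hΩ
  obtain ⟨C, hC⟩ := hΩ.exists_bound_of_continuousOn hg
  have hmem : MemLp g p (μ.restrict Ω) := by
    refine .of_bound (integrableOn_of_continuousOn_closure hΩ hg).aestronglyMeasurable C ?_
    filter_upwards [ae_restrict_mem hΩm] with x hx using hC x (subset_closure hx)
  exact ⟨hmem.toLp, hmem.coeFn_toLp⟩

theorem eqOn_zero_closure_of_ae_eq_zero [TopologicalSpace X] [μ.IsOpenPosMeasure]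
    (hΩ : IsOpen Ω) (hg : ContinuousOn g (closure Ω)) (hg₀ : g =ᵐ[μ.restrict Ω] 0) :
    EqOn g 0 (closure Ω) :=
  (Measure.eqOn_open_of_ae_eq hg₀ hΩ (hg.mono subset_closure) continuousOn_const).of_subset_closure
    hg continuousOn_const subset_closure le_rfl

end Topological

end L2

namespace HasRLDerivOn

variable {𝕜 : Type} [RCLike 𝕜] {ρ : ℝ} {X ι : Type*} [MetricSpace X]
  [MeasurableSpace X] [OpensMeasurableSpace X] {μ : Measure X} [IsFiniteMeasureOnCompacts μ]
  {Ω : Set X} {u H G : X → ℝ → 𝕜} {S : Lp 𝕜 2 (μ.restrict Ω) →L[𝕜] Lp 𝕜 2 (μ.restrict Ω)}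

theorem exists_integral_norm_mul_le (h : HasRLDerivOn Ω ρ u H G) (hΩm : MeasurableSet Ω)
    (hΩ : IsCompact (closure Ω))
    (hS : ∀ t > 0, LpMapsTo S (fun x => G x t) fun x => u x t)
    {ψ : X → 𝕜} (hψ : ContinuousOn ψ (closure Ω)) {ε : ℝ} (hε : 0 < ε) (R : ℝ) :
    ∃ C, ∀ t ∈ Icc ε R, ∫ x in Ω, ‖u x t * ψ x‖ ∂μ ≤ C := by
  have hfin := isFiniteMeasure_restrict_of_isCompact_closure (μ := μ) hΩ
  obtain ⟨Ψ, hΨ⟩ := exists_Lp_ae_eq_of_continuousOn_closure (μ := μ) hΩm hΩ hψ 2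
  obtain ⟨M, hM⟩ := (hΩ.prod isCompact_Icc).exists_bound_of_continuousOn
    (h.continuousOn_rlDeriv.mono (prod_mono le_rfl fun s (hs : s ∈ Icc ε R) => hε.trans_le hs.1))
  set K : ℝ := measureUnivNNReal (μ.restrict Ω) ^ (2 : ENNReal).toReal⁻¹ * |M|
  refine ⟨‖S‖ * K * ‖Ψ‖, fun t ht => ?_⟩
  have ht₀ : 0 < t := hε.trans_le ht.1
  obtain ⟨U, hU⟩ := exists_Lp_ae_eq_of_continuousOn_closure (μ := μ) hΩm hΩ (h.continuousOn t ht₀) 2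
  obtain ⟨F, hF⟩ := exists_Lp_ae_eq_of_continuousOn_closure (μ := μ) hΩm hΩ
    (h.continuousOn_rlDeriv.uncurry_right t ht₀) 2
  have hFK : ‖F‖ ≤ K := by
    refine Lp.norm_le_of_ae_bound (abs_nonneg M) ?_
    filter_upwards [hF, ae_restrict_mem hΩm] with x hx hxΩ
    rw [hx]
    exact (hM (x, t) ⟨subset_closure hxΩ, ht⟩).trans (le_abs_self M)
  calc ∫ x in Ω, ‖u x t * ψ x‖ ∂μ ≤ ‖U‖ * ‖Ψ‖ := integral_norm_mul_le hU hΨ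
    _ = ‖S F‖ * ‖Ψ‖ := by rw [hS t ht₀ F U hF hU]
    _ ≤ ‖S‖ * K * ‖Ψ‖ := by gcongr; exact S.le_opNorm_of_le hFK

variable [SecondCountableTopology X] [μ.IsOpenPosMeasure]
  {V : HilbertBasis ι 𝕜 (Lp 𝕜 2 (μ.restrict Ω))} {v : ι → X → 𝕜} {κ : ι → 𝕜}

theorem rlInt_eq_zero (h : HasRLDerivOn Ω ρ u H G) (hΩo : IsOpen Ω)
    (hΩ : IsCompact (closure Ω)) (hρ₀ : 0 < ρ) (hρ₁ : ρ ≤ 1)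
    (hS : ∀ t > 0, LpMapsTo S (fun x => G x t) fun x => u x t)
    (hv : ∀ k, ContinuousOn (v k) (closure Ω)) (hVv : ∀ k, V k =ᵐ[μ.restrict Ω] v k)
    (hSV : ∀ k, S (V k) = κ k • V k) (hκ : ∀ k, κ k ≠ 0) {t : ℝ} (ht : 0 < t) :
    EqOn (fun x => H x t) 0 (closure Ω) := by
  have hΩm := hΩo.measurableSet
  have hrep : ∀ {g : X → 𝕜}, ContinuousOn g (closure Ω) →
      ∃ F : Lp 𝕜 2 (μ.restrict Ω), F =ᵐ[μ.restrict Ω] g := fun hg =>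
    exists_Lp_ae_eq_of_continuousOn_closure hΩm hΩ hg 2
  have hstar : ∀ k, ContinuousOn (fun x => star (v k x)) (closure Ω) := fun k =>
    continuous_star.comp_continuousOn (hv k)
  have hcoeff : ∀ k, ∫ x in Ω, H x t * star (v k x) ∂μ = 0 := fun k => by
    refine (h.mul_right (hstar k)).setIntegral_rlInt_eq_zero hΩm hΩ hρ₀ hρ₁
      (fun ε hε R => h.exists_integral_norm_mul_le hΩm hΩ hS (hstar k) hε R) (hκ k)
      (fun s hs => ?_) ht
    obtain ⟨U, hU⟩ := hrep (h.continuousOn s hs)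
    obtain ⟨F, hF⟩ := hrep (h.continuousOn_rlDeriv.uncurry_right s hs)
    rw [← inner_eq_integral_mul_star (hVv k) hU, ← inner_eq_integral_mul_star (hVv k) hF,
      ← hS s hs F U hF hU, inner_apply_eq_mul_inner_of_hilbertBasis V hSV]
  have hHt : ContinuousOn (fun x => H x t) (closure Ω) :=
    h.continuousOn_rlInt.uncurry_right t ht.le
  obtain ⟨F, hF⟩ := hrep hHt
  obtain rfl : F = 0 := eq_zero_of_forall_inner_hilbertBasis_eq_zero V fun k => by
    rw [inner_eq_integral_mul_star (hVv k) hF, hcoeff k]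
  exact eqOn_zero_closure_of_ae_eq_zero hΩo hHt (hF.symm.trans (Lp.coeFn_zero _ _ _))

theorem eq_zero (h : HasRLDerivOn Ω ρ u H G) (hΩo : IsOpen Ω) (hΩ : IsCompact (closure Ω))
    (hρ₀ : 0 < ρ) (hρ₁ : ρ ≤ 1)
    (hS : ∀ t > 0, LpMapsTo S (fun x => G x t) fun x => u x t)
    (hv : ∀ k, ContinuousOn (v k) (closure Ω)) (hVv : ∀ k, V k =ᵐ[μ.restrict Ω] v k)
    (hSV : ∀ k, S (V k) = κ k • V k) (hκ : ∀ k, κ k ≠ 0) {t : ℝ} (ht : 0 < t) :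
    EqOn (fun x => u x t) 0 (closure Ω) := by
  have hΩm := hΩo.measurableSet
  have hG : ∀ x ∈ Ω, G x t = 0 := fun x hx => by
    refine (h.hasDerivAt x hx t ht).unique
      ((hasDerivAt_const t (0 : 𝕜)).congr_of_eventuallyEq ?_)
    filter_upwards [Ioi_mem_nhds ht] with s hs using
      h.rlInt_eq_zero hΩo hΩ hρ₀ hρ₁ hS hv hVv hSV hκ hs (subset_closure hx)
  obtain ⟨U, hU⟩ := exists_Lp_ae_eq_of_continuousOn_closure (μ := μ) hΩm hΩ (h.continuousOn t ht) 2
  obtain rfl : U = 0 := by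
    have hG₀ : (0 : Lp 𝕜 2 (μ.restrict Ω)) =ᵐ[μ.restrict Ω] fun x => G x t := by
      filter_upwards [Lp.coeFn_zero 𝕜 2 (μ.restrict Ω), ae_restrict_mem hΩm] with x hx hxΩ
      rw [hx, hG x hxΩ, Pi.zero_apply]
    rw [← hS t ht 0 U hG₀ hU, map_zero]
  exact eqOn_zero_closure_of_ae_eq_zero hΩo (h.continuousOn t ht)
    (hU.symm.trans (Lp.coeFn_zero _ _ _))

end HasRLDerivOn

section DifferentialOperators

variable {𝕜 : Type} [RCLike 𝕜] {N : ℕ} {Ω : Set (Sp N)} {f g : Sp N → 𝕜}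

theorem partialD_congr (hΩ : IsOpen Ω) (i : Fin N) (h : EqOn f g Ω) :
    EqOn (partialD i f) (partialD i g) Ω := fun x hx => by
  have hfg : f =ᶠ[𝓝 x] g := h.eventuallyEq_of_mem (hΩ.mem_nhds hx)
  simp only [partialD, hfg.fderiv_eq]

theorem partialD_sub (hΩ : IsOpen Ω) (i : Fin N) (hf : ContDiffOn ℝ 1 f Ω)
    (hg : ContDiffOn ℝ 1 g Ω) :
    EqOn (partialD i (f - g)) (partialD i f - partialD i g) Ω := fun x hx => by
  have hdf := (hf.differentiableOn one_ne_zero).differentiableAt (hΩ.mem_nhds hx)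
  have hdg := (hg.differentiableOn one_ne_zero).differentiableAt (hΩ.mem_nhds hx)
  simp [partialD, fderiv_sub hdf hdg]

theorem contDiffOn_partialD (hΩ : IsOpen Ω) (i : Fin N) {n : ℕ}
    (hf : ContDiffOn ℝ (n + 1 : ℕ) f Ω) : ContDiffOn ℝ n (partialD i f) Ω :=
  (hf.fderiv_of_isOpen hΩ (m := n) (by norm_cast)).clm_apply contDiffOn_const

theorem contDiffOn_foldr_partialD (hΩ : IsOpen Ω) (L : List (Fin N)) {n : ℕ}
    (hf : ContDiffOn ℝ (n + L.length : ℕ) f Ω) : ContDiffOn ℝ n (L.foldr partialD f) Ω := by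
  induction L generalizing n with
  | nil => exact hf
  | cons i L ih =>
    refine contDiffOn_partialD hΩ i (ih ?_)
    rwa [List.length_cons, Nat.add_comm L.length, ← add_assoc] at hf

theorem foldr_partialD_sub (hΩ : IsOpen Ω) (L : List (Fin N)) (hf : ContDiffOn ℝ L.length f Ω)
    (hg : ContDiffOn ℝ L.length g Ω) :
    EqOn (L.foldr partialD (f - g)) (L.foldr partialD f - L.foldr partialD g) Ω := by
  induction L with
  | nil => exact eqOn_refl _ _
  | cons i L ih =>
    rw [List.length_cons] at hf hg
    have hle : (L.length : WithTop ℕ∞) ≤ (L.length + 1 : ℕ) := by norm_cast; omega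
    have hC1 : ∀ {h : Sp N → 𝕜}, ContDiffOn ℝ (L.length + 1 : ℕ) h Ω →
        ContDiffOn ℝ 1 (L.foldr partialD h) Ω := fun hh =>
      contDiffOn_foldr_partialD hΩ L (by rwa [add_comm 1])
    exact (partialD_congr hΩ i (ih (hf.of_le hle) (hg.of_le hle))).trans
      (partialD_sub hΩ i (hC1 hf) (hC1 hg))

theorem foldr_replicate_partialD (i : Fin N) (k : ℕ) (g : Sp N → 𝕜) :
    (List.replicate k i).foldr partialD g = (partialD i)^[k] g := by
  induction k with
  | zero => rfl
  | succ k ih => rw [List.replicate_succ, List.foldr_cons, ih, Function.iterate_succ_apply']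

theorem multiD_eq_foldr (α : Fin N → ℕ) (g : Sp N → 𝕜) :
    multiD α g =
      ((List.finRange N).flatMap fun i => List.replicate (α i) i).foldr partialD g := by
  simp only [multiD, List.foldr_flatMap, foldr_replicate_partialD]

theorem length_flatMap_replicate (α : Fin N → ℕ) :
    ((List.finRange N).flatMap fun i => List.replicate (α i) i).length = ∑ i, α i := by
  simp [List.length_flatMap, ← List.ofFn_eq_map, List.sum_ofFn]

theorem sum_le_of_mem_multiIdx {k : ℕ} {α : Fin N → ℕ} (hα : α ∈ multiIdx N k) :
    ∑ i, α i ≤ k :=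
  (Finset.mem_filter.1 hα).2

theorem multiIdx_mono {j k : ℕ} (hjk : j ≤ k) : multiIdx N j ⊆ multiIdx N k := by
  intro α hα
  simp only [multiIdx, Finset.mem_filter, Fintype.mem_piFinset, Finset.mem_range] at hα ⊢
  exact ⟨fun i => (hα.1 i).trans_le (Nat.succ_le_succ hjk), hα.2.trans hjk⟩

theorem multiD_sub (hΩ : IsOpen Ω) {k : ℕ} {α : Fin N → ℕ} (hα : α ∈ multiIdx N k)
    (hf : ContDiffOn ℝ k f Ω) (hg : ContDiffOn ℝ k g Ω) :
    EqOn (multiD α (f - g)) (multiD α f - multiD α g) Ω := by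
  have hk : ((∑ i, α i : ℕ) : WithTop ℕ∞) ≤ k := by exact_mod_cast sum_le_of_mem_multiIdx hα
  simp only [multiD_eq_foldr]
  refine foldr_partialD_sub hΩ _ ?_ ?_ <;> rw [length_flatMap_replicate]
  exacts [hf.of_le hk, hg.of_le hk]

theorem diffOp_sub (hΩ : IsOpen Ω) {m : ℕ} (a : (Fin N → ℕ) → Sp N → 𝕜)
    (hf : ContDiffOn ℝ m f Ω) (hg : ContDiffOn ℝ m g Ω) :
    EqOn (diffOp m a (f - g)) (diffOp m a f - diffOp m a g) Ω := fun x hx => by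
  simp only [diffOp, Pi.sub_apply, ← Finset.sum_sub_distrib]
  refine Finset.sum_congr rfl fun α hα => ?_
  rw [multiD_sub hΩ hα hf hg hx, Pi.sub_apply, mul_sub]

theorem CkClosure.sub (hΩ : IsOpen Ω) {k : ℕ} (hf : CkClosure Ω k f) (hg : CkClosure Ω k g) :
    CkClosure Ω k (f - g) := by
  refine ⟨hf.1.sub hg.1, hf.2.1.sub hg.2.1, fun α hα => ?_⟩
  obtain ⟨F, hF, hFf⟩ := hf.2.2 α hα
  obtain ⟨G, hG, hGg⟩ := hg.2.2 α hα
  refine ⟨F - G, hF.sub hG, fun x hx => ?_⟩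
  rw [multiD_sub hΩ hα hf.1 hg.1 hx, Pi.sub_apply, Pi.sub_apply, hFf hx, hGg hx]

theorem CkClosure.exists_tendsto_multiD {k : ℕ} (hf : CkClosure Ω k f) {α : Fin N → ℕ}
    (hα : α ∈ multiIdx N k) {x : Sp N} (hx : x ∈ closure Ω) :
    ∃ y, Tendsto (multiD α f) (𝓝[Ω] x) (𝓝 y) := by
  obtain ⟨F, hF, hFf⟩ := hf.2.2 α hα
  exact ⟨F x, ((hF x hx).mono subset_closure).tendsto.congr'
    (hFf.eventuallyEq_of_mem self_mem_nhdsWithin)⟩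

theorem bdryOp_sub (hΩ : IsOpen Ω) {j k : ℕ} (hjk : j ≤ k) (b : (Fin N → ℕ) → Sp N → 𝕜)
    (hf : CkClosure Ω k f) (hg : CkClosure Ω k g) :
    EqOn (bdryOp Ω j b (f - g)) (bdryOp Ω j b f - bdryOp Ω j b g) (frontier Ω) := fun x hx => by
  have hxΩ := frontier_subset_closure hx
  simp only [bdryOp, Pi.sub_apply, ← Finset.sum_sub_distrib]
  refine Finset.sum_congr rfl fun α hα => ?_
  have hαk := multiIdx_mono hjk hα
  obtain ⟨y, hy⟩ := hf.exists_tendsto_multiD hαk hxΩ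
  obtain ⟨z, hz⟩ := hg.exists_tendsto_multiD hαk hxΩ
  have hyz : Tendsto (multiD α (f - g)) (𝓝[Ω] x) (𝓝 (y - z)) :=
    (hy.sub hz).congr' ((multiD_sub hΩ hαk hf.1 hg.1).symm.eventuallyEq_of_mem self_mem_nhdsWithin)
  rw [extendFrom_eq hxΩ hyz, extendFrom_eq hxΩ hy, extendFrom_eq hxΩ hz, mul_sub]

end DifferentialOperators

section Difference

variable {𝕜 : Type} [RCLike 𝕜] {N : ℕ} {Ω : Set (Sp N)}

theorem ExtendsCont.sub {I : Set ℝ} {g h k : Sp N → ℝ → 𝕜} (hg : ExtendsCont Ω I g)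
    (hh : ExtendsCont Ω I h) (hk : ∀ x ∈ Ω, ∀ t > 0, k x t = g x t - h x t) :
    ExtendsCont Ω I k := by
  obtain ⟨G, hG, hGg⟩ := hg
  obtain ⟨H, hH, hHh⟩ := hh
  refine ⟨fun x t => G x t - H x t, hG.sub hH, fun x hx t ht => ?_⟩
  rw [hk x hx t ht, ← hGg x hx t ht, ← hHh x hx t ht]

namespace IsRegularSolution

variable {l : ℕ} {a : (Fin N → ℕ) → Sp N → 𝕜} {mB : Fin l → ℕ}
  {b : Fin l → (Fin N → ℕ) → Sp N → 𝕜} {ρ : ℝ} {f g : Sp N → ℝ → 𝕜} {φ ψ : Sp N → 𝕜}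
  {u v : Sp N → ℝ → 𝕜} {x : Sp N} {t : ℝ}

theorem rlInt_sub (hu : IsRegularSolution Ω l a mB b ρ f φ u)
    (hv : IsRegularSolution Ω l a mB b ρ g ψ v) (hx : x ∈ Ω) (ht : 0 < t) :
    rlInt (ρ - 1) ((u - v) x) t = rlInt (ρ - 1) (u x) t - rlInt (ρ - 1) (v x) t :=
  Subdiffusion.rlInt_sub (hu.integral_exists x hx t ht) (hv.integral_exists x hx t ht)

theorem hasDerivAt_rlInt_sub (hu : IsRegularSolution Ω l a mB b ρ f φ u)
    (hv : IsRegularSolution Ω l a mB b ρ g ψ v) (hx : x ∈ Ω) (ht : 0 < t) :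
    HasDerivAt (rlInt (ρ - 1) ((u - v) x)) (rlDeriv ρ (u x) t - rlDeriv ρ (v x) t) t := by
  refine ((hu.deriv_exists x hx t ht).hasDerivAt.sub
    (hv.deriv_exists x hx t ht).hasDerivAt).congr_of_eventuallyEq ?_
  filter_upwards [Ioi_mem_nhds ht] with s hs using hu.rlInt_sub hv hx hs

theorem sub (hΩ : IsOpen Ω) (hmB : ∀ j, mB j ≤ 2 * l)
    (hu : IsRegularSolution Ω l a mB b ρ f φ u) (hv : IsRegularSolution Ω l a mB b ρ g ψ v) :
    IsRegularSolution Ω l a mB b ρ (f - g) (φ - ψ) (u - v) := by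
  have hderiv : ∀ x ∈ Ω, ∀ t > 0,
      rlDeriv ρ ((u - v) x) t = rlDeriv ρ (u x) t - rlDeriv ρ (v x) t := fun x hx t ht =>
    (hu.hasDerivAt_rlInt_sub hv hx ht).deriv
  have hop : ∀ x ∈ Ω, ∀ t > 0, diffOp (2 * l) a (fun y => (u - v) y t) x =
      diffOp (2 * l) a (fun y => u y t) x - diffOp (2 * l) a (fun y => v y t) x :=
    fun x hx t ht => diffOp_sub hΩ a (hu.space_regular t ht).1 (hv.space_regular t ht).1 hx
  exact
  { space_regular := fun t ht => (hu.space_regular t ht).sub hΩ (hv.space_regular t ht)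
    integral_exists := fun x hx t ht =>
      (hu.integral_exists x hx t ht).sub (hv.integral_exists x hx t ht)
    deriv_exists := fun x hx t ht => (hu.hasDerivAt_rlInt_sub hv hx ht).differentiableAt
    continuous_rlDeriv := hu.continuous_rlDeriv.sub hv.continuous_rlDeriv hderiv
    continuous_diffOp := hu.continuous_diffOp.sub hv.continuous_diffOp hop
    continuous_rlInt := hu.continuous_rlInt.sub hv.continuous_rlInt
      fun x hx t ht => hu.rlInt_sub hv hx ht
    equation := fun x hx t ht => by
      rw [hderiv x hx t ht, hop x hx t ht, sub_add_sub_comm, hu.equation x hx t ht,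
        hv.equation x hx t ht, Pi.sub_apply, Pi.sub_apply]
    initial := fun x hx => by
      refine ((hu.initial x hx).sub (hv.initial x hx)).congr' ?_
      filter_upwards [self_mem_nhdsWithin] with t ht using (hu.rlInt_sub hv hx ht).symm
    boundary := fun j t ht x hx => by
      have hbdry := bdryOp_sub hΩ (hmB j) (b j) (hu.space_regular t ht) (hv.space_regular t ht) hx
      rwa [Pi.sub_apply, hu.boundary j t ht x hx, hv.boundary j t ht x hx, sub_self] at hbdry }

theorem exists_hasRLDerivOn (hu : IsRegularSolution Ω l a mB b ρ f 0 u) :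
    ∃ H G, HasRLDerivOn Ω ρ u H G ∧ ∀ x ∈ Ω, ∀ t > 0, G x t = rlDeriv ρ (u x) t := by
  obtain ⟨G, hG, hGu⟩ := hu.continuous_rlDeriv
  obtain ⟨H, hH, hHu⟩ := hu.continuous_rlInt
  refine ⟨H, G, ⟨fun t ht => (hu.space_regular t ht).2.1, hu.integral_exists,
    fun x hx t ht => (hHu x hx t ht).symm, fun x hx t ht => ?_, hH, hG, fun x hx => ?_⟩, hGu⟩
  · rw [hGu x hx t ht]
    refine (hu.deriv_exists x hx t ht).hasDerivAt.congr_of_eventuallyEq ?_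
    filter_upwards [Ioi_mem_nhds ht] with s hs using hHu x hx s hs
  · have hH₀ : Tendsto (H x) (𝓝[>] 0) (𝓝 (H x 0)) :=
      ((hH.uncurry_left x (subset_closure hx) 0 self_mem_Ici).mono Ioi_subset_Ici_self).tendsto
    refine tendsto_nhds_unique hH₀ ((hu.initial x hx).congr' ?_)
    filter_upwards [self_mem_nhdsWithin] with s hs using (hHu x hx s hs).symm

end IsRegularSolution

end Difference

section Uniqueness

variable {𝕜 : Type} [RCLike 𝕜] {N : ℕ} {Ω : Set (Sp N)} {l : ℕ} {a : (Fin N → ℕ) → Sp N → 𝕜}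
  {mB : Fin l → ℕ} {b : Fin l → (Fin N → ℕ) → Sp N → 𝕜}

/-- `T` is a left inverse in `L₂(Ω)` of the operator `A(x,D)` with domain `D(A)`. -/
def IsL2LeftInverse (Ω : Set (Sp N)) (l : ℕ) (a : (Fin N → ℕ) → Sp N → 𝕜) (mB : Fin l → ℕ)
    (b : Fin l → (Fin N → ℕ) → Sp N → 𝕜) (T : L2 𝕜 Ω →L[𝕜] L2 𝕜 Ω) : Prop :=
  ∀ g, InDomain Ω l mB b g → LpMapsTo T (diffOp (2 * l) a g) g

/-- The functions `v k ∈ D(A)` solve the spectral problem `A v = lam k v`, and their classes form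
the orthonormal basis `V` of `L₂(Ω)`. -/
structure IsEigenbasis {ι : Type*} (Ω : Set (Sp N)) (l : ℕ) (a : (Fin N → ℕ) → Sp N → 𝕜)
    (mB : Fin l → ℕ) (b : Fin l → (Fin N → ℕ) → Sp N → 𝕜) (v : ι → Sp N → 𝕜) (lam : ι → 𝕜)
    (V : HilbertBasis ι 𝕜 (L2 𝕜 Ω)) : Prop where
  inDomain : ∀ k, InDomain Ω l mB b (v k)
  diffOp_eq : ∀ k, ∀ x ∈ Ω, diffOp (2 * l) a (v k) x = lam k * v k x
  ae_eq : ∀ k, V k =ᵐ[volume.restrict Ω] v k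

theorem ConditionA.exists_isL2LeftInverse_isEigenbasis (hA : ConditionA Ω l a mB b) :
    ∃ T, IsL2LeftInverse Ω l a mB b T ∧
      ∃ v lam, ∃ V : HilbertBasis ℕ 𝕜 (L2 𝕜 Ω), IsEigenbasis Ω l a mB b v lam V := by
  obtain ⟨T, -, hT⟩ := hA.compact_inverse
  obtain ⟨v, lam, V, hv, -, hlam, hVv, hVo, hVd⟩ := hA.eigenfunctions
  refine ⟨T, hT, v, fun k => lam k, HilbertBasis.mk hVo hVd.ge, hv, hlam, fun k => ?_⟩
  rw [HilbertBasis.coe_mk]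
  exact hVv k

namespace IsEigenbasis

variable {ι : Type*} {v : ι → Sp N → 𝕜} {lam : ι → 𝕜} {V : HilbertBasis ι 𝕜 (L2 𝕜 Ω)}
  {T : L2 𝕜 Ω →L[𝕜] L2 𝕜 Ω}

theorem map_smul_eq (hV : IsEigenbasis Ω l a mB b v lam V) (hΩ : MeasurableSet Ω)
    (hT : IsL2LeftInverse Ω l a mB b T) (k : ι) : T (lam k • V k) = V k := by
  refine hT (v k) (hV.inDomain k) _ _ ?_ (hV.ae_eq k)
  filter_upwards [Lp.coeFn_smul (lam k) (V k), hV.ae_eq k, ae_restrict_mem hΩ] with x hx hVx hxΩ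
  rw [hx, Pi.smul_apply, hVx, hV.diffOp_eq k x hxΩ, smul_eq_mul]

theorem eigenvalue_ne_zero (hV : IsEigenbasis Ω l a mB b v lam V) (hΩ : MeasurableSet Ω)
    (hT : IsL2LeftInverse Ω l a mB b T) (k : ι) : lam k ≠ 0 := fun hk =>
  V.orthonormal.ne_zero k (by rw [← hV.map_smul_eq hΩ hT k, hk, zero_smul, map_zero])

theorem map_eq_inv_smul (hV : IsEigenbasis Ω l a mB b v lam V) (hΩ : MeasurableSet Ω)
    (hT : IsL2LeftInverse Ω l a mB b T) (k : ι) : T (V k) = (lam k)⁻¹ • V k := by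
  rw [eq_inv_smul_iff₀ (hV.eigenvalue_ne_zero hΩ hT k), ← map_smul, hV.map_smul_eq hΩ hT k]

end IsEigenbasis

theorem IsL2LeftInverse.neg_lpMapsTo {T : L2 𝕜 Ω →L[𝕜] L2 𝕜 Ω}
    (hT : IsL2LeftInverse Ω l a mB b T) (hΩ : MeasurableSet Ω) {g h : Sp N → 𝕜}
    (hg : InDomain Ω l mB b g) (hgh : ∀ x ∈ Ω, h x + diffOp (2 * l) a g x = 0) :
    LpMapsTo (-T) h g := fun F G hF hG => by
  rw [neg_apply, ← map_neg]
  refine hT g hg (-F) G ?_ hG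
  filter_upwards [Lp.coeFn_neg F, hF, ae_restrict_mem hΩ] with x hx hFx hxΩ
  rw [hx, Pi.neg_apply, hFx, neg_eq_of_add_eq_zero_right (hgh x hxΩ)]

theorem IsRegularSolution.eq_zero {ι : Type*} {v : ι → Sp N → 𝕜} {lam : ι → 𝕜}
    {V : HilbertBasis ι 𝕜 (L2 𝕜 Ω)} {T : L2 𝕜 Ω →L[𝕜] L2 𝕜 Ω} {ρ t : ℝ} {u : Sp N → ℝ → 𝕜}
    (hu : IsRegularSolution Ω l a mB b ρ 0 0 u) (hΩ : IsOpen Ω) (hb : Bornology.IsBounded Ω)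
    (hT : IsL2LeftInverse Ω l a mB b T) (hV : IsEigenbasis Ω l a mB b v lam V) (hρ₀ : 0 < ρ)
    (hρ₁ : ρ ≤ 1) (ht : 0 < t) : EqOn (fun x => u x t) 0 (closure Ω) := by
  have hΩm := hΩ.measurableSet
  obtain ⟨H, G, h, hG⟩ := hu.exists_hasRLDerivOn
  refine h.eq_zero (S := -T) (κ := fun k => -(lam k)⁻¹) hΩ hb.isCompact_closure hρ₀ hρ₁
    (fun s hs => ?_) (fun k => (hV.inDomain k).1.2.1) hV.ae_eq (fun k => ?_)
    (fun k => neg_ne_zero.2 (inv_ne_zero (hV.eigenvalue_ne_zero hΩm hT k))) ht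
  · refine hT.neg_lpMapsTo hΩm ⟨hu.space_regular s hs, fun j => hu.boundary j s hs⟩ fun x hx => ?_
    rw [hG x hx s hs]
    exact hu.equation x hx s hs
  · rw [neg_apply, hV.map_eq_inv_smul hΩm hT k, neg_smul]

end Uniqueness

end Subdiffusion

end

theorem theorem1_general {𝕜 : Type} [RCLike 𝕜] {N : ℕ} {Ω : Set (Subdiffusion.Sp N)}
    (hΩ : IsOpen Ω) (hb : Bornology.IsBounded Ω) {l : ℕ}
    {a : (Fin N → ℕ) → Subdiffusion.Sp N → 𝕜} {mB : Fin l → ℕ} (hmB : ∀ j, mB j ≤ 2 * l)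
    {b : Fin l → (Fin N → ℕ) → Subdiffusion.Sp N → 𝕜}
    {T : Subdiffusion.L2 𝕜 Ω →L[𝕜] Subdiffusion.L2 𝕜 Ω}
    (hT : Subdiffusion.IsL2LeftInverse Ω l a mB b T) {ι : Type*}
    {v : ι → Subdiffusion.Sp N → 𝕜} {lam : ι → 𝕜}
    {V : HilbertBasis ι 𝕜 (Subdiffusion.L2 𝕜 Ω)}
    (hV : Subdiffusion.IsEigenbasis Ω l a mB b v lam V) {ρ : ℝ} (hρ₀ : 0 < ρ) (hρ₁ : ρ ≤ 1)
    {f : Subdiffusion.Sp N → ℝ → 𝕜} {φ : Subdiffusion.Sp N → 𝕜}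
    {u₁ u₂ : Subdiffusion.Sp N → ℝ → 𝕜}
    (hu₁ : Subdiffusion.IsRegularSolution Ω l a mB b ρ f φ u₁)
    (hu₂ : Subdiffusion.IsRegularSolution Ω l a mB b ρ f φ u₂) :
    ∀ x ∈ closure Ω, ∀ t > 0, u₁ x t = u₂ x t := by
  intro x hx t ht
  have hu := hu₁.sub hΩ hmB hu₂
  rw [sub_self, sub_self] at hu
  exact sub_eq_zero.1 (hu.eq_zero hΩ hb hT hV hρ₀ hρ₁ ht hx)

theorem theorem1 {𝕜 : Type} [RCLike 𝕜] {N : ℕ} (hN : 1 ≤ N)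
    (Ω : Set (Subdiffusion.Sp N)) (hΩ : Subdiffusion.IsSmoothBoundedDomain Ω)
    (l : ℕ) (hl : 1 ≤ l)
    (a : (Fin N → ℕ) → Subdiffusion.Sp N → 𝕜) (ha : Subdiffusion.IsPosSymmElliptic Ω l a)
    (mB : Fin l → ℕ) (hmB : ∀ j, mB j ≤ 2 * l - 1)
    (b : Fin l → (Fin N → ℕ) → Subdiffusion.Sp N → 𝕜)
    (hA : Subdiffusion.ConditionA Ω l a mB b)
    (ρ : ℝ) (hρ0 : 0 < ρ) (hρ1 : ρ ≤ 1)
    (f : Subdiffusion.Sp N → ℝ → 𝕜)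
    (hf : ContinuousOn (Function.uncurry f) (closure Ω ×ˢ Set.Ioi 0))
    (φ : Subdiffusion.Sp N → 𝕜) (hφ : ContinuousOn φ (closure Ω))
    (u₁ u₂ : Subdiffusion.Sp N → ℝ → 𝕜)
    (hu₁ : Subdiffusion.IsRegularSolution Ω l a mB b ρ f φ u₁)
    (hu₂ : Subdiffusion.IsRegularSolution Ω l a mB b ρ f φ u₂) :
    ∀ x ∈ closure Ω, ∀ t > 0, u₁ x t = u₂ x t := by
  obtain ⟨T, hT, v, lam, V, hV⟩ := hA.exists_isL2LeftInverse_isEigenbasis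
  exact theorem1_general hΩ.isOpen hΩ.isBounded (fun j => (hmB j).trans (Nat.sub_le _ _)) hT hV
    hρ0 hρ1 hu₁ hu₂
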